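/- **Setting.** Let $q\in\{1,2,3,4\}$, $b\in\mathbb{R}$ with $|b|<1$, and $\varepsilon>0$. On the torus $\mathbb{T}=[0,2\pi]$ (periodic boundary conditions) consider, for $t\ge 0$, the linear hyperbolic relaxation system $$\partial_t u+\partial_x(bu+w)=0,\qquad \partial_t w+\partial_x\big((1-b^2)u-bw\big)=-\frac1\varepsilon w ,$$ whose (weak, complex-valued) solutions are taken in $C([0,\infty);L^2(\mathbb{T}))$. Write $\|\cdot\|$ for the $L^2(\mathbb T)$ norm (of the inner product $\frac1{2\pi}\int_0^{2\pi} f\bar g\,dx$), $\|f\|_{H^s}^2=\sum_{k\in\mathbb Z}(1+k^2)^s|\hat f_k|^2$, $\mathbb{P}_N=\mathrm{span}\{e^{ikx}:|k|\le N\}$ and $\mathcal{P}_N f=\sum_{|k|\le N}\hat f_k e^{ikx}$. **Scheme.** Let $$\beta=\Big(\sum_{j=1}^q\tfrac1j\Big)^{-1},\quad \beta\sum_{j=1}^q\tfrac1j\zeta^{q-j}(\zeta-1)^j=\sum_{i=0}^q\alpha_i\zeta^i,\quad \beta(\zeta^q-(\zeta-1)^q)=\sum_{i=0}^{q-1}\gamma_i\zeta^i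 .$$ Given a starting time $T_0\ge 0$ and a time step $\Delta t>0$, put $t_n=T_0+n\Delta t$. The Fourier–Galerkin IMEX-BDF scheme of order $q$ determines $U_N^n,W_N^n\in\mathbb{P}_N$ by $U_N^i=\mathcal{P}_Nu(t_i)$, $W_N^i=\mathcal{P}_Nw(t_i)$ for $i=0,\dots,q-1$ and, for $n\ge 0$, $$\sum_{i=0}^q\alpha_iU_N^{n+i}+\Delta t\sum_{i=0}^{q-1}\gamma_i\,\partial_x\big(bU_N^{n+i}+W_N^{n+i}\big)=0,$$ $$\sum_{i=0}^q\alpha_iW_N^{n+i}+\Delta t\sum_{i=0}^{q-1}\gamma_i\,\partial_x\big((1-b^2)U_N^{n+i}-bW_N^{n+i}\big)=-\frac{\beta\Delta t}{\varepsilon}W_N^{n+q}.$$ **Well-prepared data.** Let $K\ge 0$. Assume one of the following. * *Case 1 (consistency up to order $q$).* $u,w\in C^{q+1}([0,\infty);L^2(\mathbb T))$, $$\|\partial_t^{q+1}u(0)\|_{H^1}+\|\partial_t^{q+1}w(0)\|_{H^1}\le K,\qquad \|\partial_t^{q}u(0)\|_{H^2}+\|\partial_t^{q}w(0)\|_{H^2}\le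 K,$$ and $T_0\ge 0$ is arbitrary. * *Case 2.* $\|u(0)\|_{H^{q+2}}^2+\|w(0)\|_{H^{q+2}}^2\le K$, $T_0\ge 0$ and $T_0\ge (q+2)\,\varepsilon\log(1/\varepsilon)$. **Theorem (uniform accuracy of IMEX-BDF schemes).** For every $q\in\{1,2,3,4\}$, $|b|<1$, $c_{CFL}>0$, $T$ and $K$ there is a constant $C>0$, independent of $\varepsilon$, $N$ and $\Delta t$ (and depending on the solution only through $K$), such that in Case 1 and in Case 2, for every $\varepsilon>0$ and all $N$, $\Delta t$ with $0<\Delta t\le\min\{c_{CFL}/N^2,1\}$ (the first bound being void if $N=0$), $$\|u(t_n)-U_N^n\|^2+\|w(t_n)-W_N^n\|^2\le C\big(\Delta t^{2q}+e_{\mathrm{proj}}\big)$$ for every $n\ge 0$ with $t_n=T_0+n\Delta t\le T$, where $$e_{\mathrm{proj}}=\sum_{i=0}^{q-1}\Big(\|(I-\mathcal{P}_N)u(t_i)\|^2+\Big(1+\frac{\Delta t}{\varepsilon}\Big)\|(I-\mathcal{P}_N)w(t_i)\|^2\Big).$$ -/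

import Mathlib

open scoped BigOperators NNReal ENNReal
open Real (pi)

namespace IMEXBDF

noncomputable section

instance fact_two_pi_pos : Fact (0 < 2 * pi) := ⟨Real.two_pi_pos⟩

/-- The torus `[0, 2π]` with its end points identified. -/
abbrev Torus : Type := AddCircle (2 * pi)

/-- Complex-valued square-integrable functions on the torus, with the norm of the inner product
`⟨f, g⟩ = (1 / 2π) ∫ f * conj g dx`. -/
abbrev L2 : Type := MeasureTheory.Lp ℂ 2 (AddCircle.haarAddCircle (T := 2 * pi))

/-- The `H^s` norm of a function on the torus, `(∑ₖ (1 + k²)^s |f̂ₖ|²)^(1/2)`; it takes the value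
`∞` exactly when `f` is not in `H^s`. -/
def sobolevNorm (s : ℕ) (f : L2) : ℝ≥0∞ :=
  (∑' k : ℤ, ENNReal.ofReal ((1 + (k : ℝ) ^ 2) ^ s * ‖fourierCoeff (f : Torus → ℂ) k‖ ^ 2)) ^
    (1 / 2 : ℝ)

/-- `(u, w)` is a weak solution, continuous in time with values in `L²`, of
`∂ₜ u + ∂ₓ (b u + w) = 0`, `∂ₜ w + ∂ₓ ((1 - b²) u - b w) = - w / ε`
on the torus for times `t ≥ 0`: the equations hold after testing in space with smooth
`2π`-periodic functions. Only the values at times `t ≥ 0` matter. -/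
structure IsSolution (b ε : ℝ) (u w : ℝ → L2) : Prop where
  continuous_u : ContinuousOn u (Set.Ici 0)
  continuous_w : ContinuousOn w (Set.Ici 0)
  eq_u : ∀ φ : ℝ → ℂ, ContDiff ℝ (⊤ : ℕ∞) φ → Function.Periodic φ (2 * pi) → ∀ t : ℝ, 0 ≤ t →
    HasDerivWithinAt
      (fun s : ℝ => ∫ x in (0 : ℝ)..(2 * pi), (u s : Torus → ℂ) (x : Torus) * φ x)
      (∫ x in (0 : ℝ)..(2 * pi),
        ((b : ℂ) * (u t : Torus → ℂ) (x : Torus) + (w t : Torus → ℂ) (x : Torus)) * deriv φ x)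
      (Set.Ici 0) t
  eq_w : ∀ φ : ℝ → ℂ, ContDiff ℝ (⊤ : ℕ∞) φ → Function.Periodic φ (2 * pi) → ∀ t : ℝ, 0 ≤ t →
    HasDerivWithinAt
      (fun s : ℝ => ∫ x in (0 : ℝ)..(2 * pi), (w s : Torus → ℂ) (x : Torus) * φ x)
      ((∫ x in (0 : ℝ)..(2 * pi),
          ((1 - (b : ℂ) ^ 2) * (u t : Torus → ℂ) (x : Torus)
            - (b : ℂ) * (w t : Torus → ℂ) (x : Torus)) * deriv φ x)
        - (1 / (ε : ℂ)) * ∫ x in (0 : ℝ)..(2 * pi), (w t : Torus → ℂ) (x : Torus) * φ x)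
      (Set.Ici 0) t

/-- `β = 1 / (∑_{j=1}^q 1/j)`. -/
def bdfBeta (q : ℕ) : ℝ := 1 / ∑ j ∈ Finset.Icc 1 q, 1 / (j : ℝ)

/-- `α(ζ) = β ∑_{j=1}^q (1/j) ζ^(q-j) (ζ-1)^j`. -/
def bdfAlphaPoly (q : ℕ) : Polynomial ℝ :=
  Polynomial.C (bdfBeta q) * ∑ j ∈ Finset.Icc 1 q,
    Polynomial.C (1 / (j : ℝ)) * Polynomial.X ^ (q - j) * (Polynomial.X - 1) ^ j

/-- `γ(ζ) = β (ζ^q - (ζ-1)^q)`. -/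
def bdfGammaPoly (q : ℕ) : Polynomial ℝ :=
  Polynomial.C (bdfBeta q) * (Polynomial.X ^ q - (Polynomial.X - 1) ^ q)

/-- The coefficients `αᵢ` of the scheme, `α(ζ) = ∑ αᵢ ζⁱ`. -/
def bdfAlpha (q i : ℕ) : ℝ := (bdfAlphaPoly q).coeff i

/-- The coefficients `γᵢ` of the scheme, `γ(ζ) = ∑ γᵢ ζⁱ`. -/
def bdfGamma (q i : ℕ) : ℝ := (bdfGammaPoly q).coeff i

/-- The trigonometric polynomials of degree at most `N`: the span of `e^{ikx}`, `-N ≤ k ≤ N`. -/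
def trigPoly (N : ℕ) : Submodule ℂ L2 :=
  Submodule.span ℂ ((fun k : ℤ => (fourierLp 2 k : L2)) '' Set.Icc (-(N : ℤ)) (N : ℤ))

/-- The projection `P_N f = ∑_{|k| ≤ N} f̂ₖ e^{ikx}`. -/
def proj (N : ℕ) (f : L2) : L2 :=
  ∑ k ∈ Finset.Icc (-(N : ℤ)) (N : ℤ), fourierCoeff (f : Torus → ℂ) k • (fourierLp 2 k : L2)

/-- The derivative `∂ₓ f = ∑_{|k| ≤ N} i k f̂ₖ e^{ikx}` of a trigonometric polynomial `f` of degree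
at most `N` (it is applied only to such `f`). -/
def trigDeriv (N : ℕ) (f : L2) : L2 :=
  ∑ k ∈ Finset.Icc (-(N : ℤ)) (N : ℤ),
    (Complex.I * (k : ℂ) * fourierCoeff (f : Torus → ℂ) k) • (fourierLp 2 k : L2)

/-- `(U, W)` is produced by the `q`-th order Fourier-Galerkin IMEX-BDF scheme with `|k| ≤ N`, time
step `Δt` and starting time `T₀`, the starting values being the projections of the exact solution
`(u, w)` at the times `T₀ + i Δt`, `i < q`. -/
structure IsScheme (q : ℕ) (b ε Δt T₀ : ℝ) (N : ℕ) (u w : ℝ → L2) (U W : ℕ → L2) : Prop where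
  mem_U : ∀ n, U n ∈ trigPoly N
  mem_W : ∀ n, W n ∈ trigPoly N
  start_U : ∀ i < q, U i = proj N (u (T₀ + i * Δt))
  start_W : ∀ i < q, W i = proj N (w (T₀ + i * Δt))
  step_U : ∀ n,
    (∑ i ∈ Finset.range (q + 1), bdfAlpha q i • U (n + i))
      + Δt • ∑ i ∈ Finset.range q,
          bdfGamma q i • trigDeriv N (b • U (n + i) + W (n + i)) = 0
  step_W : ∀ n,
    (∑ i ∈ Finset.range (q + 1), bdfAlpha q i • W (n + i))
      + Δt • ∑ i ∈ Finset.range q,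
          bdfGamma q i • trigDeriv N ((1 - b ^ 2) • U (n + i) - b • W (n + i))
      = -((bdfBeta q * Δt / ε) • W (n + q))

/-- The `m`-th time derivative at time `0` (one-sided). -/
def timeDerivZero (m : ℕ) (u : ℝ → L2) : L2 := iteratedDerivWithin m u (Set.Ici 0) 0

/-- Case 1: the initial data are consistent up to order `q`, with bound `K`. The one-sided time
derivatives are those of `u` and `w` as curves in `L²`, which are required to exist. -/
structure ConsistentData (q : ℕ) (K : ℝ≥0) (u w : ℝ → L2) : Prop where
  contDiff_u : ContDiffOn ℝ ((q + 1 : ℕ) : WithTop ℕ∞) u (Set.Ici 0)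
  contDiff_w : ContDiffOn ℝ ((q + 1 : ℕ) : WithTop ℕ∞) w (Set.Ici 0)
  bound_one : sobolevNorm 1 (timeDerivZero (q + 1) u) + sobolevNorm 1 (timeDerivZero (q + 1) w) ≤ K
  bound_two : sobolevNorm 2 (timeDerivZero q u) + sobolevNorm 2 (timeDerivZero q w) ≤ K

/-- The projection error of the starting values. -/
def projError (q : ℕ) (ε Δt T₀ : ℝ) (N : ℕ) (u w : ℝ → L2) : ℝ :=
  ∑ i ∈ Finset.range q,
    (‖u (T₀ + i * Δt) - proj N (u (T₀ + i * Δt))‖ ^ 2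
      + (1 + Δt / ε) * ‖w (T₀ + i * Δt) - proj N (w (T₀ + i * Δt))‖ ^ 2)

end

end IMEXBDF

namespace IMEXBDF

/-! ### The coefficients of the scheme -/

/-! The problem decouples in Fourier space. On mode `k` the system is an ODE `y' = M y` in `ℂ × ℂ`
with `M = -ik (flux) - (1/ε) (projection to w)`, and the scheme is a recursion with the same
matrices. It is enough to bound the squared error of mode `k` by a constant, independent of `k` and
`ε`, times `Δt^(2q) B_k²` with `∑ B_k²` bounded, and to sum by Parseval. Modes beyond `N` are not
computed; the energy bounds them by their size at `T₀`, which belongs to the projection error.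

Stability (`exists_stability_constant`): scaling `u` by `√(1 - b²)` makes the flux symmetric, hence
`i` times it skew. Test the error recursion with `e_q - (3/4) e_{q-1}`. The BDF part gives the
difference of a positive definite functional plus squares of increments. The implicit relaxation
gives a telescoping term of good sign, however large `Δt/ε` is. In the explicit flux term skewness
removes the product of `e_{q-1}` with itself, so each remaining product contains an increment;
Young's inequality then leaves `(kΔt)² ≤ c_CFL Δt` times the energy, and a discrete Grönwall
argument concludes.

Consistency (`exists_mode_consistency`): by Taylor's formula the residual is `O(Δt^(q+1))` times
bounds for `M^(q+1) y` and `k M^q y`, with no further power of `1/ε`. For consistent data, `M^m y`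
is again a solution, so the energy carries its bound from time `0` onwards. For data after a waiting
time (`exists_layer_constant`), either `1/ε` is at most `4(1 + |k|)` and `M` itself is `O(1 + |k|)`,
or `M` has one fast and one slow eigenvalue and the wait has damped the fast component by `ε^(q+1)`,
enough to offset `q + 1` derivatives. -/

theorem coeff_X_sub_one_pow (j n : ℕ) :
    ((Polynomial.X - 1 : Polynomial ℝ) ^ j).coeff n = (-1) ^ (j - n) * (j.choose n : ℝ) := by
  rw [sub_eq_add_neg, ← Polynomial.C_1, ← Polynomial.C_neg, Polynomial.coeff_X_add_C_pow]

/-- The factor `ζ^(q-j)` shifts the binomial coefficients of `(ζ-1)^j`; in this closed form every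
coefficient with concrete `q` and `i` is a numeral. -/
theorem bdfAlpha_eq (q i : ℕ) :
    bdfAlpha q i = bdfBeta q * ∑ j ∈ Finset.Icc 1 q, (1 / (j : ℝ)) *
      (if q - j ≤ i then (-1) ^ (j - (i - (q - j))) * (j.choose (i - (q - j)) : ℝ) else 0) := by
  unfold bdfAlpha bdfAlphaPoly
  rw [Polynomial.coeff_C_mul, Polynomial.finsetSum_coeff]
  congr 1
  refine Finset.sum_congr rfl fun j _ => ?_
  rw [mul_assoc, Polynomial.coeff_C_mul, Polynomial.coeff_X_pow_mul', coeff_X_sub_one_pow]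

theorem bdfGamma_eq (q i : ℕ) (h : i < q) :
    bdfGamma q i = -(bdfBeta q * ((-1) ^ (q - i) * (q.choose i : ℝ))) := by
  unfold bdfGamma bdfGammaPoly
  rw [Polynomial.coeff_C_mul, Polynomial.coeff_sub, Polynomial.coeff_X_pow, if_neg h.ne,
    coeff_X_sub_one_pow]
  ring

theorem bdfBeta_pos (q : ℕ) (hq : 1 ≤ q) : 0 < bdfBeta q := by
  unfold bdfBeta
  refine one_div_pos.2 (Finset.sum_pos (fun j hj => ?_) ⟨1, by simpa using hq⟩)
  have : (0 : ℝ) < j := by exact_mod_cast (Finset.mem_Icc.1 hj).1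
  positivity

/-- `∑ αᵢ iᵐ = β m q^(m-1)` for `m ≤ q`: the backward difference formula differentiates
polynomials of degree at most `q` exactly. -/
theorem bdfAlpha_moment (q : ℕ) (hq1 : 1 ≤ q) (hq4 : q ≤ 4) (m : ℕ) (hm : m ≤ q) :
    ∑ i ∈ Finset.range (q + 1), bdfAlpha q i * (i : ℝ) ^ m
      = bdfBeta q * m * (q : ℝ) ^ (m - 1) := by
  interval_cases q <;> interval_cases m <;>
  norm_num [Finset.sum_range_succ, bdfAlpha_eq, bdfBeta, Finset.sum_Icc_succ_top, Nat.choose]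

/-- `∑ γᵢ iᵐ = β qᵐ` for `m < q`: the extrapolation is exact on polynomials of degree less
than `q`. -/
theorem bdfGamma_moment (q : ℕ) (hq1 : 1 ≤ q) (hq4 : q ≤ 4) (m : ℕ) (hm : m < q) :
    ∑ i ∈ Finset.range q, bdfGamma q i * (i : ℝ) ^ m = bdfBeta q * (q : ℝ) ^ m := by
  rw [Finset.sum_congr rfl fun i hi => by rw [bdfGamma_eq q i (Finset.mem_range.1 hi)]]
  interval_cases q <;> interval_cases m <;>
  norm_num [Finset.sum_range_succ, bdfBeta, Finset.sum_Icc_succ_top, Nat.choose]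

/-! ### A quadratic Lyapunov functional for the backward difference formulas -/

/-- `Φ` is a positive definite function of `v 0, …, v (q - 1)` for which the backward difference
formula, tested with the multiplier `v q - (3/4) v (q - 1)`, dissipates the increments of `v`. -/
structure IsLyapunov (q : ℕ) (g δ : ℝ) (Φ : (ℕ → ℝ) → ℝ) : Prop where
  lower : ∀ v, g * ∑ i ∈ Finset.range q, v i ^ 2 ≤ Φ v
  zero : ∀ v, (∀ i < q, v i = 0) → Φ v = 0
  step : ∀ v : ℕ → ℝ, Φ (fun i => v (1 + i)) - Φ v
      + δ * ∑ i ∈ Finset.range q, (v (i + 1) - v i) ^ 2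
    ≤ (v q - 3 / 4 * v (q - 1)) * ∑ i ∈ Finset.range (q + 1), bdfAlpha q i * v i

/-- Here and for `q = 2, 3, 4` the weights of `Φ` are such that the slack in `step` is a quadratic
form in the increments `v (i + 1) - v i` alone. The squares supplied for larger `q` come from
successively completing squares. The constants `1/200` and `1/25` are common to all four orders. -/
theorem isLyapunov_one : IsLyapunov 1 (1 / 200) (1 / 25) (fun v => 1 / 8 * v 0 * v 0) where
  lower v := by
    norm_num [Finset.sum_range_succ]
    nlinarith [sq_nonneg (v 0)]
  zero v h := by simp [h]
  step v := by
    norm_num [Finset.sum_range_succ, bdfAlpha_eq, bdfBeta, Finset.sum_Icc_succ_top, Nat.choose]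
    nlinarith [sq_nonneg (v 1 - v 0)]

theorem isLyapunov_two : IsLyapunov 2 (1 / 200) (1 / 25) (fun v =>
    101 / 240 * v 0 * v 0 - 37 / 40 * v 1 * v 0 + 47 / 80 * v 1 * v 1) where
  lower v := by
    norm_num [Finset.sum_range_succ]
    nlinarith [sq_nonneg (v 0), sq_nonneg (v 1), sq_nonneg (v 0 - 555/493*v 1)]
  zero v h := by simp [h]
  step v := by
    norm_num [Finset.sum_range_succ, bdfAlpha_eq, bdfBeta, Finset.sum_Icc_succ_top, Nat.choose]
    linarith [sq_nonneg ((v 1 - v 0) - 200/457*(v 2 - v 1)), sq_nonneg (v 2 - v 1)]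

theorem isLyapunov_three : IsLyapunov 3 (1 / 200) (1 / 25) (fun v =>
    137/660*v 0*v 0 - 431/660*v 1*v 0 + 2621/2640*v 1*v 1 + 17/60*v 2*v 0
      - 179/120*v 2*v 1 + 35/48*v 2*v 2) where
  lower v := by
    norm_num [Finset.sum_range_succ]
    linarith [sq_nonneg (v 0), sq_nonneg (v 1), sq_nonneg (v 2),
      sq_nonneg (v 0 - 2155/1304*v 1 + 935/1304*v 2), sq_nonneg (v 1 - 44485/38529*v 2)]
  zero v h := by simp [h]
  step v := by
    norm_num [Finset.sum_range_succ, bdfAlpha_eq, bdfBeta, Finset.sum_Icc_succ_top, Nat.choose]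
    linarith [sq_nonneg ((v 1 - v 0) - 785/1106*(v 2 - v 1) + 300/553*(v 3 - v 2)),
      sq_nonneg ((v 2 - v 1) - 408745/785998*(v 3 - v 2)), sq_nonneg (v 3 - v 2)]

theorem isLyapunov_four : IsLyapunov 4 (1 / 200) (1 / 25) (fun v =>
    67/800*v 0*v 0 - 117/400*v 1*v 0 + 1273/2400*v 1*v 1 + 103/400*v 2*v 0
      - 1643/1200*v 2*v 1 + 3217/2400*v 2*v 2 - 13/80*v 3*v 0 + 877/1200*v 3*v 1
      - 2159/1200*v 3*v 2 + 1777/2400*v 3*v 3) where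
  lower v := by
    norm_num [Finset.sum_range_succ]
    linarith [sq_nonneg (v 3), sq_nonneg (v 0 - 13/7*v 1 + 103/63*v 2 - 65/63*v 3),
      sq_nonneg (v 1 - 1871/1066*v 2 + 901/1066*v 3), sq_nonneg (v 2 - 748759/658223*v 3)]
  zero v h := by simp [h]
  step v := by
    norm_num [Finset.sum_range_succ, bdfAlpha_eq, bdfBeta, Finset.sum_Icc_succ_top, Nat.choose]
    linarith [sq_nonneg ((v 1 - v 0) - 10/7*(v 2 - v 1) + 53/35*(v 3 - v 2) - 48/35*(v 4 - v 3)),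
      sq_nonneg ((v 2 - v 1) - 1294/1825*(v 3 - v 2) + 1563/1825*(v 4 - v 3)),
      sq_nonneg ((v 3 - v 2) - 5204/9257*(v 4 - v 3)), sq_nonneg (v 4 - v 3)]

theorem exists_isLyapunov (q : ℕ) (hq1 : 1 ≤ q) (hq4 : q ≤ 4) :
    ∃ Φ, IsLyapunov q (1 / 200) (1 / 25) Φ := by
  interval_cases q
  exacts [⟨_, isLyapunov_one⟩, ⟨_, isLyapunov_two⟩, ⟨_, isLyapunov_three⟩, ⟨_, isLyapunov_four⟩]

/-! ### Stability of the scheme in a Euclidean space -/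

theorem norm_sub_le_sum_increments {E : Type*} [SeminormedAddCommGroup E] (y : ℕ → E) {i n : ℕ} (hi : i ≤ n) :
    ‖y i - y n‖ ≤ ∑ j ∈ Finset.range (n + 1), ‖y (j + 1) - y j‖ := by
  rw [norm_sub_rev, ← Finset.sum_Ico_sub y hi]
  refine (norm_sum_le _ _).trans (Finset.sum_le_sum_of_subset_of_nonneg (fun j hj => ?_)
    fun _ _ _ => norm_nonneg _)
  rw [Finset.mem_range]
  have := (Finset.mem_Ico.1 hj).2
  omega

theorem mul_le_mul_sq_add_sq_div {a b δ : ℝ} (hδ : 0 < δ) : a * b ≤ δ * a ^ 2 + b ^ 2 / (4 * δ) := by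
  have : δ * a ^ 2 + b ^ 2 / (4 * δ) - a * b = (2 * δ * a - b) ^ 2 / (4 * δ) := by
    field_simp
    ring
  have : 0 ≤ (2 * δ * a - b) ^ 2 / (4 * δ) := by positivity
  linarith

section Stability

variable {H : Type*} [NormedAddCommGroup H] [InnerProductSpace ℝ H]

/-- Testing the skew term with the multiplier costs only `O(l²)` after part of the increments
has been used. -/
theorem skew_term_le (q : ℕ) (hq1 : 1 ≤ q) (hq4 : q ≤ 4) {J : H →ₗ[ℝ] H}
    (hJ : ∀ x, inner ℝ x (J x) = 0) (hJ1 : ∀ x, ‖J x‖ ≤ ‖x‖) {δ : ℝ} (hδ : 0 < δ) (l : ℝ)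
    (y : ℕ → H) :
    -(l * inner ℝ (y q - (3 / 4 : ℝ) • y (q - 1)) (∑ i ∈ Finset.range q, bdfGamma q i • J (y i)))
      ≤ 2 * δ * ∑ i ∈ Finset.range q, ‖y (i + 1) - y i‖ ^ 2
        + q * (∑ i ∈ Finset.range q, |bdfGamma q i|) ^ 2 / δ * l ^ 2
            * ∑ i ∈ Finset.range q, ‖y i‖ ^ 2 := by
  set Γ := ∑ i ∈ Finset.range q, |bdfGamma q i| with hΓ
  set d := y (q - 1 + 1) - y (q - 1) with hd
  set S := ∑ i ∈ Finset.range q, bdfGamma q i • y i with hS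
  have hΓ0 : 0 ≤ Γ := Finset.sum_nonneg fun _ _ => abs_nonneg _
  have hqpos : (1 : ℝ) ≤ q := by exact_mod_cast hq1
  have hmem : q - 1 ∈ Finset.range q := Finset.mem_range.2 (by omega)
  have hq' : q - 1 + 1 = q := by omega
  set D2 := ∑ i ∈ Finset.range q, ‖y (i + 1) - y i‖ ^ 2 with hD2
  set Y2 := ∑ i ∈ Finset.range q, ‖y i‖ ^ 2 with hY2
  set D1 := ∑ i ∈ Finset.range q, ‖y (i + 1) - y i‖ with hD1
  set Y1 := ∑ i ∈ Finset.range q, ‖y i‖ with hY1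
  have hD12 : D1 ^ 2 ≤ q * D2 := by
    simpa using sq_sum_le_card_mul_sum_sq (s := Finset.range q) (f := fun i => ‖y (i + 1) - y i‖)
  have hY12 : Y1 ^ 2 ≤ q * Y2 := by
    simpa using sq_sum_le_card_mul_sum_sq (s := Finset.range q) (f := fun i => ‖y i‖)
  have hdD : ‖d‖ ^ 2 ≤ D2 :=
    Finset.single_le_sum (f := fun i => ‖y (i + 1) - y i‖ ^ 2) (fun _ _ => by positivity) hmem
  have hyY : ‖y (q - 1)‖ ^ 2 ≤ Y2 :=
    Finset.single_le_sum (f := fun i => ‖y i‖ ^ 2) (fun _ _ => by positivity) hmem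
  have hSn : ‖S‖ ≤ Γ * Y1 := by
    rw [hΓ, Finset.sum_mul]
    refine (norm_sum_le _ _).trans (Finset.sum_le_sum fun i hi => ?_)
    rw [norm_smul, Real.norm_eq_abs]
    gcongr
    exact Finset.single_le_sum (f := fun i => ‖y i‖) (fun _ _ => by positivity) hi
  have hSd : ‖S - bdfBeta q • y (q - 1)‖ ≤ Γ * D1 := by
    have h0 := bdfGamma_moment q hq1 hq4 0 (by omega)
    simp only [pow_zero, mul_one] at h0
    rw [← h0, Finset.sum_smul, hS, ← Finset.sum_sub_distrib, hΓ, Finset.sum_mul]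
    refine (norm_sum_le _ _).trans (Finset.sum_le_sum fun i hi => ?_)
    rw [← smul_sub, norm_smul, Real.norm_eq_abs]
    gcongr
    have := norm_sub_le_sum_increments y (i := i) (n := q - 1)
      (by have := Finset.mem_range.1 hi; omega)
    rwa [hq'] at this
  have hJS : ∑ i ∈ Finset.range q, bdfGamma q i • J (y i) = J S := by simp [hS]
  have hm : y q - (3 / 4 : ℝ) • y (q - 1) = d + (1 / 4 : ℝ) • y (q - 1) := by
    rw [hd, hq']
    module
  -- The term `β ⟨y (q - 1), J (y (q - 1))⟩` vanishes by skewness and may be subtracted freely.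
  -- Since the `γᵢ` sum to `β`, the vector `S - β y (q - 1)` is a combination of increments, so both
  -- products contain an increment.
  have hsplit : inner ℝ (y q - (3 / 4 : ℝ) • y (q - 1)) (J S)
      = inner ℝ d (J S) + 1 / 4 * inner ℝ (y (q - 1)) (J (S - bdfBeta q • y (q - 1))) := by
    rw [hm, inner_add_left, real_inner_smul_left, map_sub, map_smul, inner_sub_right,
      real_inner_smul_right, hJ]
    ring
  have h1 : |inner ℝ d (J S)| ≤ ‖d‖ * (Γ * Y1) :=
    (abs_real_inner_le_norm _ _).trans (by gcongr; exact (hJ1 _).trans hSn)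
  have h2 : |inner ℝ (y (q - 1)) (J (S - bdfBeta q • y (q - 1)))| ≤ ‖y (q - 1)‖ * (Γ * D1) :=
    (abs_real_inner_le_norm _ _).trans (by gcongr; exact (hJ1 _).trans hSd)
  rw [hJS, hsplit]
  have h3 : -(l * (inner ℝ d (J S)
        + 1 / 4 * inner ℝ (y (q - 1)) (J (S - bdfBeta q • y (q - 1)))))
      ≤ |l| * (‖d‖ * (Γ * Y1)) + |l| * (‖y (q - 1)‖ * (Γ * D1)) := by
    refine (neg_le_abs _).trans ?_
    rw [abs_mul, ← mul_add]
    gcongr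
    refine (abs_add_le _ _).trans (add_le_add h1 ?_)
    rw [abs_mul, abs_of_pos (by norm_num : (0 : ℝ) < 1 / 4)]
    have := abs_nonneg (inner ℝ (y (q - 1)) (J (S - bdfBeta q • y (q - 1))))
    linarith
  have h4 := mul_le_mul_sq_add_sq_div (a := ‖d‖) (b := |l| * Γ * Y1) hδ
  -- The weight `δ / q` offsets the Cauchy–Schwarz loss `D1² ≤ q D2`.
  have h5 := mul_le_mul_sq_add_sq_div (a := D1) (b := |l| * Γ * ‖y (q - 1)‖)
    (div_pos hδ (by linarith : (0 : ℝ) < q))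
  have h6 : (|l| * Γ * Y1) ^ 2 / (4 * δ) ≤ q * Γ ^ 2 / δ * l ^ 2 * Y2 / 4 := by
    rw [mul_pow, mul_pow, sq_abs]
    calc l ^ 2 * Γ ^ 2 * Y1 ^ 2 / (4 * δ) ≤ l ^ 2 * Γ ^ 2 * (q * Y2) / (4 * δ) := by gcongr
      _ = _ := by field_simp
  have h7 : (|l| * Γ * ‖y (q - 1)‖) ^ 2 / (4 * (δ / q)) ≤ q * Γ ^ 2 / δ * l ^ 2 * Y2 / 4 := by
    rw [mul_pow, mul_pow, sq_abs]
    calc l ^ 2 * Γ ^ 2 * ‖y (q - 1)‖ ^ 2 / (4 * (δ / q))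
        ≤ l ^ 2 * Γ ^ 2 * Y2 / (4 * (δ / q)) := by gcongr
      _ = _ := by field_simp
  have h8 : δ / q * D1 ^ 2 ≤ δ * D2 := by
    calc δ / q * D1 ^ 2 ≤ δ / q * (q * D2) := by gcongr
      _ = _ := by field_simp
  have h9 : δ * ‖d‖ ^ 2 ≤ δ * D2 := by gcongr
  have h10 : 0 ≤ q * Γ ^ 2 / δ * l ^ 2 * Y2 := by positivity
  linarith

variable [FiniteDimensional ℝ H]

/-- The functional `Φ`, summed over the coordinates in an orthonormal basis. -/
noncomputable def coordSum (Φ : (ℕ → ℝ) → ℝ) (y : ℕ → H) : ℝ :=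
  ∑ j, Φ (fun n => inner ℝ (stdOrthonormalBasis ℝ H j) (y n))

theorem sum_coord_sq (x : H) : ∑ j, inner ℝ (stdOrthonormalBasis ℝ H j) x ^ 2 = ‖x‖ ^ 2 := by
  rw [← (stdOrthonormalBasis ℝ H).sum_sq_norm_inner_right x]
  simp

theorem sum_coord_mul (x y : H) :
    ∑ j, inner ℝ (stdOrthonormalBasis ℝ H j) x * inner ℝ (stdOrthonormalBasis ℝ H j) y
      = inner ℝ x y := by
  rw [← (stdOrthonormalBasis ℝ H).sum_inner_mul_inner x y]
  exact Finset.sum_congr rfl fun j _ => by rw [real_inner_comm]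

theorem IsLyapunov.coordSum_lower {q : ℕ} {g δ : ℝ} {Φ : (ℕ → ℝ) → ℝ} (hΦ : IsLyapunov q g δ Φ)
    (y : ℕ → H) : g * ∑ i ∈ Finset.range q, ‖y i‖ ^ 2 ≤ coordSum Φ y := by
  refine le_trans (le_of_eq ?_) (Finset.sum_le_sum fun j _ => hΦ.lower _)
  rw [← Finset.mul_sum, Finset.sum_comm]
  simp_rw [sum_coord_sq]

theorem IsLyapunov.coordSum_zero {q : ℕ} {g δ : ℝ} {Φ : (ℕ → ℝ) → ℝ} (hΦ : IsLyapunov q g δ Φ)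
    (y : ℕ → H) (hy : ∀ i < q, y i = 0) : coordSum Φ y = 0 :=
  Finset.sum_eq_zero fun j _ => hΦ.zero _ fun i hi => by rw [hy i hi, inner_zero_right]

/-- The scalar inequality is applied to each coordinate sequence; by Parseval the squares and
products add up to norms and inner products. -/
theorem IsLyapunov.coordSum_step {q : ℕ} {g δ : ℝ} {Φ : (ℕ → ℝ) → ℝ} (hΦ : IsLyapunov q g δ Φ)
    (y : ℕ → H) :
    coordSum Φ (fun i => y (1 + i)) - coordSum Φ y
        + δ * ∑ i ∈ Finset.range q, ‖y (i + 1) - y i‖ ^ 2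
      ≤ inner ℝ (y q - (3 / 4 : ℝ) • y (q - 1))
          (∑ i ∈ Finset.range (q + 1), bdfAlpha q i • y i) := by
  have h := Finset.sum_le_sum fun j (_ : j ∈ Finset.univ) =>
    hΦ.step (fun n => inner ℝ (stdOrthonormalBasis ℝ H j) (y n))
  rw [Finset.sum_add_distrib, Finset.sum_sub_distrib, ← Finset.mul_sum, Finset.sum_comm] at h
  simp_rw [← inner_sub_right, sum_coord_sq] at h
  refine h.trans (le_of_eq ?_)
  rw [← sum_coord_mul]
  refine Finset.sum_congr rfl fun j _ => ?_
  rw [inner_sub_right, inner_smul_right, inner_sum]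
  simp_rw [inner_smul_right]

/-- One step of the scheme: the energy grows by a factor `1 + O(h)`. -/
theorem energy_step (q : ℕ) (hq1 : 1 ≤ q) (hq4 : q ≤ 4) {Φ : (ℕ → ℝ) → ℝ}
    (hΦ : IsLyapunov q (1 / 200) (1 / 25) Φ) {J P : H →ₗ[ℝ] H}
    (hJ : ∀ x, inner ℝ x (J x) = 0) (hJ1 : ∀ x, ‖J x‖ ≤ ‖x‖)
    (hP : ∀ x y, inner ℝ x (P y) = inner ℝ (P x) (P y))
    {c h l z F : ℝ} (hh : 0 ≤ h) (hh1 : h ≤ 1) (hl : l ^ 2 ≤ c * h) (hz : 0 ≤ z)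
    {y : ℕ → H} {f : H} (hf : ‖f‖ ^ 2 ≤ h ^ 2 * F)
    (hy : ∑ i ∈ Finset.range (q + 1), bdfAlpha q i • y i
      + l • ∑ i ∈ Finset.range q, bdfGamma q i • J (y i) + z • P (y q) = f) :
    coordSum Φ (fun i => y (1 + i)) + 3 / 8 * z * ‖P (y q)‖ ^ 2
      ≤ coordSum Φ y + 3 / 8 * z * ‖P (y (q - 1))‖ ^ 2
        + (100 * q * (∑ i ∈ Finset.range q, |bdfGamma q i|) ^ 2 * c + 1) * h
            * ∑ i ∈ Finset.range q, ‖y i‖ ^ 2 + 26 * h * F := by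
  have hstep := hΦ.coordSum_step y
  -- Of the available `1/25` of squared increments, the skew term consumes `2/100` and the forcing
  -- below `1/100`.
  have hskew := skew_term_le q hq1 hq4 hJ hJ1 (δ := 1 / 100) (by norm_num) l y
  set Γ := ∑ i ∈ Finset.range q, |bdfGamma q i|
  have hmem : q - 1 ∈ Finset.range q := Finset.mem_range.2 (by omega)
  have hq' : q - 1 + 1 = q := by omega
  set m := y q - (3 / 4 : ℝ) • y (q - 1) with hm
  -- From `⟨a, b⟩ ≤ (‖a‖² + ‖b‖²) / 2` the tested relaxation is at least `5/8 ‖P (y q)‖² - 3/8 ‖P (y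
  -- (q - 1))‖²`. Lowering `5/8` to `3/8` makes it telescope, so the stiffness `z` enters no
  -- constant.
  have hmP : -(z * inner ℝ m (P (y q)))
      ≤ 3 / 8 * z * ‖P (y (q - 1))‖ ^ 2 - 3 / 8 * z * ‖P (y q)‖ ^ 2 := by
    have h1 : inner ℝ m (P (y q)) = ‖P (y q)‖ ^ 2 - 3 / 4 * inner ℝ (P (y (q - 1))) (P (y q)) := by
      rw [hm, inner_sub_left, real_inner_smul_left, hP, hP (y (q - 1)), real_inner_self_eq_norm_sq]
    have h2 := real_inner_le_norm (P (y (q - 1))) (P (y q))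
    have h3 : 3 / 8 * ‖P (y q)‖ ^ 2 - 3 / 8 * ‖P (y (q - 1))‖ ^ 2 ≤ inner ℝ m (P (y q)) := by
      rw [h1]
      nlinarith [sq_nonneg (‖P (y (q - 1))‖ - ‖P (y q)‖), sq_nonneg ‖P (y q)‖]
    nlinarith
  -- The multiplier is an increment plus `1/4 y (q - 1)`. The increment part costs `25 ‖f‖² ≤ 25 h
  -- F`, by `h ≤ 1`; the other part is covered by the remaining `h F` and by `h` times the sum of
  -- squares.
  have hmf : inner ℝ m f ≤ 1 / 100 * ∑ i ∈ Finset.range q, ‖y (i + 1) - y i‖ ^ 2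
      + h * ∑ i ∈ Finset.range q, ‖y i‖ ^ 2 + 26 * h * F := by
    have hdD : ‖y q - y (q - 1)‖ ^ 2 ≤ ∑ i ∈ Finset.range q, ‖y (i + 1) - y i‖ ^ 2 := by
      have := Finset.single_le_sum (f := fun i => ‖y (i + 1) - y i‖ ^ 2)
        (fun _ _ => by positivity) hmem
      simpa only [hq'] using this
    have hyY : ‖y (q - 1)‖ ^ 2 ≤ ∑ i ∈ Finset.range q, ‖y i‖ ^ 2 :=
      Finset.single_le_sum (f := fun i => ‖y i‖ ^ 2) (fun _ _ => by positivity) hmem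
    have h1 : inner ℝ m f = inner ℝ (y q - y (q - 1)) f + 1 / 4 * inner ℝ (y (q - 1)) f := by
      rw [hm, inner_sub_left, inner_sub_left, real_inner_smul_left]
      ring
    have h2 := real_inner_le_norm (y q - y (q - 1)) f
    have h3 := real_inner_le_norm (y (q - 1)) f
    have h4 := mul_le_mul_sq_add_sq_div (a := ‖y q - y (q - 1)‖) (b := ‖f‖) (δ := 1 / 100) (by norm_num)
    rw [show ‖f‖ ^ 2 / (4 * (1 / 100)) = 25 * ‖f‖ ^ 2 by ring] at h4
    have hF : h ^ 2 * F ≤ h * F := by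
      rcases eq_or_lt_of_le hh with h0 | h0
      · rw [← h0]; simp
      · have : 0 ≤ h ^ 2 * F := (sq_nonneg _).trans hf
        have hF0 : 0 ≤ F := nonneg_of_mul_nonneg_right this (by positivity)
        nlinarith [mul_nonneg hh hF0]
    have h5 : ‖y (q - 1)‖ * ‖f‖ ≤ h * ‖y (q - 1)‖ ^ 2 + h * F / 4 := by
      rcases eq_or_lt_of_le hh with h0 | h0
      · have : ‖f‖ ^ 2 ≤ 0 := by simpa [← h0] using hf
        have : ‖f‖ = 0 := by nlinarith [norm_nonneg f]
        simp [this, ← h0]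
      · refine (mul_le_mul_sq_add_sq_div h0).trans ?_
        have : ‖f‖ ^ 2 / (4 * h) ≤ h * F / 4 := by
          rw [div_le_iff₀ (by positivity)]
          nlinarith
        linarith
    have h6 : h * ‖y (q - 1)‖ ^ 2 ≤ h * ∑ i ∈ Finset.range q, ‖y i‖ ^ 2 := by gcongr
    have h7 : 0 ≤ h * ‖y (q - 1)‖ ^ 2 := by positivity
    have h8 : 0 ≤ h * F := le_trans ((sq_nonneg _).trans hf) hF
    linarith
  have hid : inner ℝ m (∑ i ∈ Finset.range (q + 1), bdfAlpha q i • y i)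
      = inner ℝ m f - l * inner ℝ m (∑ i ∈ Finset.range q, bdfGamma q i • J (y i))
        - z * inner ℝ m (P (y q)) := by
    rw [← hy, inner_add_right, inner_add_right, real_inner_smul_right, real_inner_smul_right]
    ring
  have hY2 : 0 ≤ ∑ i ∈ Finset.range q, ‖y i‖ ^ 2 := Finset.sum_nonneg fun _ _ => by positivity
  have hD2 : 0 ≤ ∑ i ∈ Finset.range q, ‖y (i + 1) - y i‖ ^ 2 :=
    Finset.sum_nonneg fun _ _ => by positivity
  have hl' : q * Γ ^ 2 / (1 / 100) * l ^ 2 * ∑ i ∈ Finset.range q, ‖y i‖ ^ 2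
      ≤ 100 * q * Γ ^ 2 * c * h * ∑ i ∈ Finset.range q, ‖y i‖ ^ 2 := by
    calc _ ≤ q * Γ ^ 2 / (1 / 100) * (c * h) * ∑ i ∈ Finset.range q, ‖y i‖ ^ 2 := by gcongr
      _ = _ := by ring
  rw [hid] at hstep
  linarith

/-- Discrete Grönwall: adding `F` makes the recursion homogeneous, since `a n + F` grows by at most
the factor `1 + C h`. -/
theorem add_le_exp_mul_of_le {a : ℕ → ℝ} {C h F : ℝ} (hC : 0 ≤ C * h) (hF : 0 ≤ F) (h0 : a 0 = 0)
    (ha : ∀ n, a (n + 1) ≤ (1 + C * h) * a n + C * h * F) (n : ℕ) :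
    a n ≤ Real.exp (C * (n * h)) * F := by
  have h1 : ∀ n, a n + F ≤ (1 + C * h) ^ n * F := by
    intro n
    induction n with
    | zero => simp [h0]
    | succ n ih =>
      rw [pow_succ']
      nlinarith [ha n, mul_le_mul_of_nonneg_left ih (by linarith : 0 ≤ 1 + C * h)]
  have h2 : (1 + C * h) ^ n ≤ Real.exp (C * (n * h)) := by
    rw [show C * (n * h) = n * (C * h) by ring, Real.exp_nat_mul]
    gcongr
    linarith [Real.add_one_le_exp (C * h)]
  have := mul_le_mul_of_nonneg_right h2 hF
  linarith [h1 n]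

/-- Stability of the scheme with zero starting values, uniformly in the stiffness `z`. -/
theorem exists_stability_constant (q : ℕ) (hq1 : 1 ≤ q) (hq4 : q ≤ 4) (c : ℝ) (hc : 0 ≤ c) :
    ∃ C : ℝ, 0 < C ∧ ∀ (H : Type) [NormedAddCommGroup H] [InnerProductSpace ℝ H]
      [FiniteDimensional ℝ H] (J P : H →ₗ[ℝ] H),
      (∀ x, inner ℝ x (J x) = 0) → (∀ x, ‖J x‖ ≤ ‖x‖) →
      (∀ x y, inner ℝ x (P y) = inner ℝ (P x) (P y)) →
      ∀ (h l z F : ℝ), 0 ≤ h → h ≤ 1 → l ^ 2 ≤ c * h → 0 ≤ z → 0 ≤ F →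
      ∀ (y f : ℕ → H), (∀ i < q, y i = 0) → (∀ n, ‖f n‖ ^ 2 ≤ h ^ 2 * F) →
      (∀ n, ∑ i ∈ Finset.range (q + 1), bdfAlpha q i • y (n + i)
        + l • ∑ i ∈ Finset.range q, bdfGamma q i • J (y (n + i)) + z • P (y (n + q)) = f n) →
      ∀ n, ‖y n‖ ^ 2 ≤ 200 * (Real.exp (C * (n * h)) * F) := by
  obtain ⟨Φ, hΦ⟩ := exists_isLyapunov q hq1 hq4
  set A := 100 * q * (∑ i ∈ Finset.range q, |bdfGamma q i|) ^ 2 * c + 1 with hA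
  have hA0 : 0 < A := by positivity
  -- `A` and `26` come from `energy_step`; `200` inverts the coercivity constant `1/200` of `Φ`.
  refine ⟨200 * A + 26, by positivity, ?_⟩
  intro H _ _ _ J P hJ hJ1 hP h l z F hh hh1 hl hz hF y f hy0 hf hy n
  have hlow : ∀ n, ∑ i ∈ Finset.range q, ‖y (n + i)‖ ^ 2 ≤ 200 * coordSum Φ fun i => y (n + i) :=
    fun n => by linarith [hΦ.coordSum_lower fun i => y (n + i)]
  -- The telescoping relaxation term is part of the energy; it is dropped only when bounding `y n`
  -- at the end.
  let a : ℕ → ℝ := fun n =>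
    coordSum Φ (fun i => y (n + i)) + 3 / 8 * z * ‖P (y (n + (q - 1)))‖ ^ 2
  have hca : ∀ n, coordSum Φ (fun i => y (n + i)) ≤ a n := fun n =>
    le_add_of_nonneg_right (by positivity)
  have ha0 : a 0 = 0 := by
    simp only [a, zero_add]
    rw [hΦ.coordSum_zero y hy0, hy0 _ (by omega)]
    simp
  have hastep : ∀ n, a (n + 1) ≤ (1 + (200 * A + 26) * h) * a n + (200 * A + 26) * h * F := by
    intro n
    have h1 := energy_step q hq1 hq4 hΦ hJ hJ1 hP hh hh1 hl hz (y := fun i => y (n + i)) (hf n)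
      (hy n)
    rw [← hA] at h1
    have h2 : A * h * ∑ i ∈ Finset.range q, ‖y (n + i)‖ ^ 2 ≤ A * h * (200 * a n) := by
      gcongr
      exact (hlow n).trans (by linarith [hca n])
    have h3 : 0 ≤ a n := by
      refine le_trans ?_ (hca n)
      have : 0 ≤ ∑ i ∈ Finset.range q, ‖y (n + i)‖ ^ 2 := Finset.sum_nonneg fun _ _ => by positivity
      linarith [hlow n]
    have h4 : a (n + 1)
        = coordSum Φ (fun i => y (n + (1 + i))) + 3 / 8 * z * ‖P (y (n + q))‖ ^ 2 := by
      simp only [a]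
      rw [show n + 1 + (q - 1) = n + q by omega]
      simp_rw [add_assoc]
    rw [h4]
    refine h1.trans ?_
    have h5 : 0 ≤ A * h * F := by positivity
    have h6 : 0 ≤ h * a n := by positivity
    have h7 : coordSum Φ (fun i => y (n + i)) + 3 / 8 * z * ‖P (y (n + (q - 1)))‖ ^ 2 = a n := rfl
    rw [h7]
    nlinarith
  have h1 := add_le_exp_mul_of_le (by positivity) hF ha0 hastep n
  have h2 : ‖y n‖ ^ 2 ≤ ∑ i ∈ Finset.range q, ‖y (n + i)‖ ^ 2 :=
    Finset.single_le_sum (f := fun i => ‖y (n + i)‖ ^ 2) (fun _ _ => by positivity)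
      (Finset.mem_range.2 hq1)
  linarith [hlow n, hca n]

end Stability

/-! ### Consistency of the scheme -/

section Consistency

variable {E : Type*} [NormedAddCommGroup E] [NormedSpace ℝ E]

/-- Taylor's formula for a sequence of functions each of which is the derivative of the one
before. -/
theorem norm_sub_taylor_le {F : ℕ → ℝ → E} {a S : ℝ}
    (hF : ∀ m, ∀ t, a ≤ t → HasDerivWithinAt (F m) (F (m + 1) t) (Set.Ici a) t) (n m : ℕ)
    (hS : ∀ t, a ≤ t → ‖F (m + n) t‖ ≤ S) {t : ℝ} (ht : a ≤ t) :
    ‖F m t - ∑ j ∈ Finset.range n, ((t - a) ^ j / (j.factorial : ℝ)) • F (m + j) a‖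
      ≤ S * ((t - a) ^ n / (n.factorial : ℝ)) := by
  induction n generalizing m t with
  | zero => simpa using hS t ht
  | succ n ih =>
    have hpow (j : ℕ) (x : ℝ) :
        HasDerivAt (fun s : ℝ => (s - a) ^ (j + 1) / ((j + 1).factorial : ℝ))
          ((x - a) ^ j / (j.factorial : ℝ)) x := by
      have h := (((hasDerivAt_id x).sub_const a).pow (j + 1)).div_const ((j + 1).factorial : ℝ)
      refine h.congr_deriv ?_
      have : (j.factorial : ℝ) ≠ 0 := by exact_mod_cast j.factorial_ne_zero
      rw [Nat.factorial_succ]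
      push_cast
      field_simp
      simp
    have hder : ∀ x, a ≤ x → HasDerivWithinAt
        (fun s => F m s - ∑ j ∈ Finset.range (n + 1),
          ((s - a) ^ j / (j.factorial : ℝ)) • F (m + j) a)
        (F (m + 1) x - ∑ j ∈ Finset.range n, ((x - a) ^ j / (j.factorial : ℝ)) • F (m + 1 + j) a)
        (Set.Ici a) x := by
      intro x hx
      refine (hF m x hx).sub ?_
      simp_rw [Finset.sum_range_succ']
      simp only [pow_zero, Nat.factorial_zero, Nat.cast_one, div_one]
      refine HasDerivWithinAt.add_const _ (HasDerivWithinAt.fun_sum fun j _ => ?_)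
      rw [show m + 1 + j = m + (j + 1) by ring]
      exact (hpow j x).hasDerivWithinAt.smul_const _
    -- The derivative of the order `n + 1` remainder of `F m` is the order `n` remainder of `F (m +
    -- 1)`, which the induction hypothesis bounds by the derivative of the claimed bound.
    refine image_norm_le_of_norm_deriv_right_le_deriv_boundary (a := a) (b := t)
      (B := fun s => S * ((s - a) ^ (n + 1) / ((n + 1).factorial : ℝ)))
      (fun x hx => ((hder x hx.1).continuousWithinAt).mono Set.Icc_subset_Ici_self)
      (fun x hx => (hder x hx.1).mono (Set.Ici_subset_Ici.2 hx.1)) ?_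
      (fun x => (hpow n x).const_mul S) (fun x hx => ih (m + 1) ?_ hx.1) ⟨ht, le_rfl⟩
    · rw [Finset.sum_range_succ']
      simp
    · intro s hs
      rw [show m + 1 + n = m + (n + 1) by ring]
      exact hS s hs

/-- Taylor's formula at the nodes `a + i h`, `i ≤ q`. -/
theorem norm_sub_taylor_step_le {F : ℕ → ℝ → E} {a S h : ℝ} (hh : 0 ≤ h)
    (hF : ∀ m, ∀ t, a ≤ t → HasDerivWithinAt (F m) (F (m + 1) t) (Set.Ici a) t) (n m : ℕ)
    (hS : ∀ t, a ≤ t → ‖F (m + n) t‖ ≤ S) {i q : ℕ} (hi : i ≤ q) :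
    ‖F m (a + i * h) - ∑ j ∈ Finset.range n,
        ((i : ℝ) ^ j * (h ^ j / (j.factorial : ℝ))) • F (m + j) a‖ ≤ (q : ℝ) ^ n * h ^ n * S := by
  have hS0 : 0 ≤ S := (norm_nonneg _).trans (hS a le_rfl)
  have h1 := norm_sub_taylor_le hF n m hS (t := a + i * h) (by nlinarith [i.cast_nonneg (α := ℝ)])
  simp only [add_sub_cancel_left, mul_pow, mul_div_assoc] at h1
  refine h1.trans ?_
  have h2 : h ^ n / (n.factorial : ℝ) ≤ h ^ n :=
    div_le_self (by positivity) (by exact_mod_cast n.factorial_pos)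
  have h3 : (i : ℝ) ^ n ≤ (q : ℝ) ^ n := by gcongr
  rw [mul_comm S]
  gcongr

/-- The local error of the backward difference formula. -/
theorem norm_bdf_defect_le (q : ℕ) (hq1 : 1 ≤ q) (hq4 : q ≤ 4) {F : ℕ → ℝ → E} {a S h : ℝ}
    (hh : 0 ≤ h)
    (hF : ∀ m, ∀ t, a ≤ t → HasDerivWithinAt (F m) (F (m + 1) t) (Set.Ici a) t)
    (hS : ∀ t, a ≤ t → ‖F (q + 1) t‖ ≤ S) :
    ‖∑ i ∈ Finset.range (q + 1), bdfAlpha q i • F 0 (a + i * h)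
        - (bdfBeta q * h) • F 1 (a + q * h)‖
      ≤ ((∑ i ∈ Finset.range (q + 1), |bdfAlpha q i|) * (q : ℝ) ^ (q + 1)
          + bdfBeta q * (q : ℝ) ^ q) * h ^ (q + 1) * S := by
  have hβ := bdfBeta_pos q hq1
  set T : ℕ → E := fun i => ∑ j ∈ Finset.range (q + 1),
    ((i : ℝ) ^ j * (h ^ j / (j.factorial : ℝ))) • F (0 + j) a with hT
  set T' : E := ∑ j ∈ Finset.range q,
    ((q : ℝ) ^ j * (h ^ j / (j.factorial : ℝ))) • F (1 + j) a with hT'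
  -- `T` is a Taylor polynomial of degree `q` and `T'` its derivative at the last node; the moment
  -- identities match them power by power, leaving only the Taylor remainders.
  have hexact : ∑ i ∈ Finset.range (q + 1), bdfAlpha q i • T i = (bdfBeta q * h) • T' := by
    simp only [hT, hT', Finset.smul_sum, smul_smul]
    rw [Finset.sum_comm]
    have : ∀ j ∈ Finset.range (q + 1), ∑ i ∈ Finset.range (q + 1),
        (bdfAlpha q i * ((i : ℝ) ^ j * (h ^ j / (j.factorial : ℝ)))) • F (0 + j) a
        = (bdfBeta q * j * (q : ℝ) ^ (j - 1) * (h ^ j / (j.factorial : ℝ))) • F (0 + j) a := by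
      intro j hj
      rw [← Finset.sum_smul, ← bdfAlpha_moment q hq1 hq4 j (by
        have := Finset.mem_range.1 hj; omega), Finset.sum_mul]
      simp_rw [mul_assoc]
    rw [Finset.sum_congr rfl this, Finset.sum_range_succ']
    simp only [Nat.cast_zero, mul_zero, zero_mul, zero_smul, add_zero]
    refine Finset.sum_congr rfl fun j _ => ?_
    rw [show 0 + (j + 1) = 1 + j by ring]
    congr 1
    have : (j.factorial : ℝ) ≠ 0 := by exact_mod_cast j.factorial_ne_zero
    rw [Nat.factorial_succ]
    push_cast
    field_simp
    ring
  have h1 : ∑ i ∈ Finset.range (q + 1), bdfAlpha q i • F 0 (a + i * h)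
        - (bdfBeta q * h) • F 1 (a + q * h)
      = ∑ i ∈ Finset.range (q + 1), bdfAlpha q i • (F 0 (a + i * h) - T i)
        - (bdfBeta q * h) • (F 1 (a + q * h) - T') := by
    simp only [smul_sub, Finset.sum_sub_distrib, hexact]
    abel
  rw [h1]
  refine (norm_sub_le _ _).trans ?_
  have h2 : ‖∑ i ∈ Finset.range (q + 1), bdfAlpha q i • (F 0 (a + i * h) - T i)‖
      ≤ (∑ i ∈ Finset.range (q + 1), |bdfAlpha q i|) * ((q : ℝ) ^ (q + 1) * h ^ (q + 1) * S) := by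
    rw [Finset.sum_mul]
    refine (norm_sum_le _ _).trans (Finset.sum_le_sum fun i hi => ?_)
    rw [norm_smul, Real.norm_eq_abs]
    gcongr
    exact norm_sub_taylor_step_le hh hF (q + 1) 0 (by simpa using hS)
      (by have := Finset.mem_range.1 hi; omega)
  have h3 : ‖(bdfBeta q * h) • (F 1 (a + q * h) - T')‖
      ≤ bdfBeta q * h * ((q : ℝ) ^ q * h ^ q * S) := by
    rw [norm_smul, Real.norm_eq_abs, abs_of_nonneg (by positivity)]
    gcongr
    exact norm_sub_taylor_step_le hh hF q 1 (by rwa [add_comm]) le_rfl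
  refine (add_le_add h2 h3).trans (le_of_eq ?_)
  ring

/-- The local error of the extrapolation. -/
theorem norm_extrapolation_defect_le (q : ℕ) (hq1 : 1 ≤ q) (hq4 : q ≤ 4) {F : ℕ → ℝ → E}
    {a S h : ℝ} (hh : 0 ≤ h)
    (hF : ∀ m, ∀ t, a ≤ t → HasDerivWithinAt (F m) (F (m + 1) t) (Set.Ici a) t)
    (hS : ∀ t, a ≤ t → ‖F q t‖ ≤ S) :
    ‖∑ i ∈ Finset.range q, bdfGamma q i • F 0 (a + i * h) - bdfBeta q • F 0 (a + q * h)‖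
      ≤ ((∑ i ∈ Finset.range q, |bdfGamma q i|) + bdfBeta q) * (q : ℝ) ^ q * h ^ q * S := by
  have hβ := bdfBeta_pos q hq1
  set T : ℕ → E := fun i => ∑ j ∈ Finset.range q,
    ((i : ℝ) ^ j * (h ^ j / (j.factorial : ℝ))) • F (0 + j) a with hT
  have hexact : ∑ i ∈ Finset.range q, bdfGamma q i • T i = bdfBeta q • T q := by
    simp only [hT, Finset.smul_sum, smul_smul]
    rw [Finset.sum_comm]
    refine Finset.sum_congr rfl fun j hj => ?_
    rw [← Finset.sum_smul, ← mul_assoc, ← bdfGamma_moment q hq1 hq4 j (Finset.mem_range.1 hj),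
      Finset.sum_mul]
    simp_rw [mul_assoc]
  have hR : ∀ i ≤ q, ‖F 0 (a + i * h) - T i‖ ≤ (q : ℝ) ^ q * h ^ q * S := fun i hi =>
    norm_sub_taylor_step_le hh hF q 0 (by simpa using hS) hi
  have h1 : ∑ i ∈ Finset.range q, bdfGamma q i • F 0 (a + i * h) - bdfBeta q • F 0 (a + q * h)
      = ∑ i ∈ Finset.range q, bdfGamma q i • (F 0 (a + i * h) - T i)
        - bdfBeta q • (F 0 (a + q * h) - T q) := by
    simp only [smul_sub, Finset.sum_sub_distrib, hexact]
    abel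
  rw [h1]
  refine (norm_sub_le _ _).trans ?_
  have h2 : ‖∑ i ∈ Finset.range q, bdfGamma q i • (F 0 (a + i * h) - T i)‖
      ≤ (∑ i ∈ Finset.range q, |bdfGamma q i|) * ((q : ℝ) ^ q * h ^ q * S) := by
    rw [Finset.sum_mul]
    refine (norm_sum_le _ _).trans (Finset.sum_le_sum fun i hi => ?_)
    rw [norm_smul, Real.norm_eq_abs]
    gcongr
    exact hR i (Finset.mem_range.1 hi).le
  have h3 : ‖bdfBeta q • (F 0 (a + q * h) - T q)‖ ≤ bdfBeta q * ((q : ℝ) ^ q * h ^ q * S) := by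
    rw [norm_smul, Real.norm_eq_abs, abs_of_pos hβ]
    gcongr
    exact hR q le_rfl
  refine (add_le_add h2 h3).trans (le_of_eq ?_)
  ring

end Consistency

/-! ### The system on one Fourier mode -/

/-- The flux matrix `(u, w) ↦ (b u + w, (1 - b²) u - b w)`. -/
noncomputable def fluxOp (b : ℝ) : ℂ × ℂ →L[ℂ] ℂ × ℂ :=
  ((b : ℂ) • ContinuousLinearMap.fst ℂ ℂ ℂ + ContinuousLinearMap.snd ℂ ℂ ℂ).prod
    ((1 - (b : ℂ) ^ 2) • ContinuousLinearMap.fst ℂ ℂ ℂ - (b : ℂ) • ContinuousLinearMap.snd ℂ ℂ ℂ)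

/-- The projection `(u, w) ↦ (0, w)`. -/
noncomputable def relaxOp : ℂ × ℂ →L[ℂ] ℂ × ℂ :=
  (0 : ℂ × ℂ →L[ℂ] ℂ).prod (ContinuousLinearMap.snd ℂ ℂ ℂ)

/-- The generator of the system on the Fourier mode `k`. -/
noncomputable def modeOp (b ε : ℝ) (k : ℤ) : ℂ × ℂ →L[ℂ] ℂ × ℂ :=
  -((Complex.I * k) • fluxOp b) - (1 / (ε : ℂ)) • relaxOp

theorem fluxOp_apply (b : ℝ) (x : ℂ × ℂ) :
    fluxOp b x = ((b : ℂ) * x.1 + x.2, (1 - (b : ℂ) ^ 2) * x.1 - (b : ℂ) * x.2) := rfl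

theorem relaxOp_apply (x : ℂ × ℂ) : relaxOp x = (0, x.2) := rfl

theorem modeOp_apply (b ε : ℝ) (k : ℤ) (x : ℂ × ℂ) :
    modeOp b ε k x = -((Complex.I * k) • fluxOp b x) - (1 / (ε : ℂ)) • relaxOp x := rfl

/-- `y` solves the system on the Fourier mode `k` for times `t ≥ 0`. -/
def IsModeSolution (b ε : ℝ) (k : ℤ) (y : ℝ → ℂ × ℂ) : Prop :=
  ∀ t, 0 ≤ t → HasDerivWithinAt y (modeOp b ε k (y t)) (Set.Ici 0) t

/-- Lets energy bounds apply to time derivatives (`B` a power of the generator) and to spectral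
components (`B` the generator minus a scalar). -/
theorem IsModeSolution.comp {b ε : ℝ} {k : ℤ} {y : ℝ → ℂ × ℂ} (hy : IsModeSolution b ε k y)
    {B : ℂ × ℂ →L[ℂ] ℂ × ℂ} (hB : Commute B (modeOp b ε k)) :
    IsModeSolution b ε k fun t => B (y t) := by
  intro t ht
  have h := (B.restrictScalars ℝ).hasFDerivAt.comp_hasDerivWithinAt t (hy t ht)
  refine h.congr_deriv ?_
  exact congrArg (fun L : ℂ × ℂ →L[ℂ] ℂ × ℂ => L (y t)) hB.eq

theorem IsModeSolution.hasDerivWithinAt_pow {b ε : ℝ} {k : ℤ} {y : ℝ → ℂ × ℂ}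
    (hy : IsModeSolution b ε k y) (m : ℕ) {t : ℝ} (ht : 0 ≤ t) :
    HasDerivWithinAt (fun t => (modeOp b ε k ^ m) (y t)) ((modeOp b ε k ^ (m + 1)) (y t))
      (Set.Ici 0) t := by
  rw [pow_succ']
  exact hy.comp ((Commute.refl _).pow_left m) t ht

/-- The energy `(1 - b²) |u|² + |w|²`. -/
noncomputable def modeEnergy (b : ℝ) (x : ℂ × ℂ) : ℝ := (1 - b ^ 2) * ‖x.1‖ ^ 2 + ‖x.2‖ ^ 2

theorem norm_sq_le_modeEnergy {b : ℝ} (hb : |b| < 1) (x : ℂ × ℂ) :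
    (1 - b ^ 2) * ‖x‖ ^ 2 ≤ modeEnergy b x := by
  have h1 : b ^ 2 < 1 := by rwa [sq_lt_one_iff_abs_lt_one]
  unfold modeEnergy
  rcases max_choice ‖x.1‖ ‖x.2‖ with h | h <;> rw [Prod.norm_def, h]
  · nlinarith [sq_nonneg ‖x.2‖]
  · nlinarith [sq_nonneg ‖x.1‖, sq_nonneg ‖x.2‖, sq_nonneg b]

theorem modeEnergy_le (b : ℝ) (x : ℂ × ℂ) : modeEnergy b x ≤ 2 * ‖x‖ ^ 2 := by
  have h1 : ‖x.1‖ ^ 2 ≤ ‖x‖ ^ 2 := by gcongr; exact norm_fst_le x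
  have h2 : ‖x.2‖ ^ 2 ≤ ‖x‖ ^ 2 := by gcongr; exact norm_snd_le x
  unfold modeEnergy
  nlinarith [mul_nonneg (sq_nonneg b) (sq_nonneg ‖x.1‖)]

/-- The weight `1 - b²` symmetrizes the flux, so the `ik` terms drop out of the energy derivative
and only the loss `(2/ε) |w|²` remains. -/
theorem IsModeSolution.modeEnergy_antitone {b ε : ℝ} {k : ℤ} {y : ℝ → ℂ × ℂ}
    (hy : IsModeSolution b ε k y) (hε : 0 < ε) :
    AntitoneOn (fun t => modeEnergy b (y t)) (Set.Ici 0) := by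
  have hder : ∀ t, 0 ≤ t → HasDerivWithinAt (fun t => modeEnergy b (y t))
      (-(2 / ε) * ‖(y t).2‖ ^ 2) (Set.Ici 0) t := by
    intro t ht
    have h1 : HasDerivWithinAt (fun t => (y t).1) (modeOp b ε k (y t)).1 (Set.Ici 0) t :=
      (ContinuousLinearMap.fst ℝ ℂ ℂ).hasFDerivAt.comp_hasDerivWithinAt t (hy t ht)
    have h2 : HasDerivWithinAt (fun t => (y t).2) (modeOp b ε k (y t)).2 (Set.Ici 0) t :=
      (ContinuousLinearMap.snd ℝ ℂ ℂ).hasFDerivAt.comp_hasDerivWithinAt t (hy t ht)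
    refine ((h1.norm_sq.const_mul (1 - b ^ 2)).add h2.norm_sq).congr_deriv ?_
    rw [Complex.sq_norm, Complex.normSq_apply, modeOp_apply, fluxOp_apply, relaxOp_apply,
      ← Complex.ofReal_one, ← Complex.ofReal_div]
    simp only [Complex.inner, Prod.fst_sub, Prod.snd_sub, Prod.fst_neg, Prod.snd_neg,
      Prod.smul_fst, Prod.smul_snd, smul_eq_mul, Complex.mul_re, Complex.mul_im, Complex.conj_re,
      Complex.conj_im, Complex.sub_re, Complex.sub_im, Complex.neg_re, Complex.neg_im,
      Complex.add_re, Complex.add_im, Complex.I_re, Complex.I_im, Complex.intCast_re,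
      Complex.intCast_im, Complex.ofReal_re, Complex.ofReal_im, ← Complex.ofReal_pow,
      Complex.zero_re, Complex.zero_im]
    field_simp
    ring
  refine antitoneOn_of_hasDerivWithinAt_nonpos (convex_Ici 0)
    (fun t ht => (hder t ht).continuousWithinAt)
    (fun t ht => (hder t (interior_subset ht)).mono interior_subset) fun t _ => ?_
  have : 0 ≤ 2 / ε * ‖(y t).2‖ ^ 2 := by positivity
  linarith

theorem IsModeSolution.norm_sq_le {b ε : ℝ} {k : ℤ} {y : ℝ → ℂ × ℂ}
    (hy : IsModeSolution b ε k y) (hε : 0 < ε) (hb : |b| < 1) {s t : ℝ} (hs : 0 ≤ s)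
    (hst : s ≤ t) : ‖y t‖ ^ 2 ≤ 2 / (1 - b ^ 2) * ‖y s‖ ^ 2 := by
  have h1 : b ^ 2 < 1 := by rwa [sq_lt_one_iff_abs_lt_one]
  have h2 := hy.modeEnergy_antitone hε (Set.mem_Ici.2 hs) (Set.mem_Ici.2 (hs.trans hst)) hst
  have h3 := (norm_sq_le_modeEnergy hb (y t)).trans (h2.trans (modeEnergy_le b (y s)))
  rw [div_mul_eq_mul_div, le_div_iff₀ (by linarith)]
  linarith

theorem IsModeSolution.norm_le {b ε : ℝ} {k : ℤ} {y : ℝ → ℂ × ℂ}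
    (hy : IsModeSolution b ε k y) (hε : 0 < ε) (hb : |b| < 1) {s t : ℝ} (hs : 0 ≤ s)
    (hst : s ≤ t) : ‖y t‖ ≤ √(2 / (1 - b ^ 2)) * ‖y s‖ := by
  have h1 : b ^ 2 < 1 := by rwa [sq_lt_one_iff_abs_lt_one]
  have h2 : 0 ≤ 2 / (1 - b ^ 2) := div_nonneg (by norm_num) (by linarith)
  refine le_of_sq_le_sq ?_ (by positivity)
  rw [mul_pow, Real.sq_sqrt h2]
  exact hy.norm_sq_le hε hb hs hst

theorem norm_fluxOp_le {b : ℝ} (hb : |b| < 1) (x : ℂ × ℂ) : ‖fluxOp b x‖ ≤ 2 * ‖x‖ := by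
  have h1 : b ^ 2 < 1 := by rwa [sq_lt_one_iff_abs_lt_one]
  have hb' : ‖(b : ℂ)‖ ≤ 1 := by rw [Complex.norm_real]; exact hb.le
  have hb2 : ‖1 - (b : ℂ) ^ 2‖ ≤ 1 := by
    rw [← Complex.ofReal_one, ← Complex.ofReal_pow, ← Complex.ofReal_sub, Complex.norm_real,
      Real.norm_eq_abs, abs_le]
    constructor <;> nlinarith [sq_nonneg b]
  rw [fluxOp_apply, Prod.norm_def, max_le_iff]
  have hx1 := norm_fst_le x
  have hx2 := norm_snd_le x
  constructor
  · refine (norm_add_le _ _).trans ?_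
    rw [norm_mul]
    nlinarith [norm_nonneg x.1]
  · refine (norm_sub_le _ _).trans ?_
    rw [norm_mul, norm_mul]
    nlinarith [norm_nonneg x.1, norm_nonneg x.2]

theorem norm_modeOp_le {b ε : ℝ} (hb : |b| < 1) (hε : 0 < ε) (k : ℤ) (x : ℂ × ℂ) :
    ‖modeOp b ε k x‖ ≤ (2 * |(k : ℝ)| + 1 / ε) * ‖x‖ := by
  rw [modeOp_apply]
  refine (norm_sub_le _ _).trans ?_
  have h1 : ‖(Complex.I * k) • fluxOp b x‖ ≤ |(k : ℝ)| * (2 * ‖x‖) := by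
    rw [norm_smul, norm_mul, Complex.norm_I, one_mul, Complex.norm_intCast]
    gcongr
    exact norm_fluxOp_le hb x
  have h2 : ‖(1 / (ε : ℂ)) • relaxOp x‖ ≤ 1 / ε * ‖x‖ := by
    rw [norm_smul, norm_div, norm_one, Complex.norm_real, Real.norm_of_nonneg hε.le]
    gcongr
    rw [relaxOp_apply, Prod.norm_def]
    exact max_le (by simp) (norm_snd_le x)
  rw [norm_neg]
  linarith

/-! ### The error on one Fourier mode -/

/-- The state space of one Fourier mode, with the Euclidean norm. -/
abbrev ModeSpace : Type := WithLp 2 (ℂ × ℂ)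

/-- The map `(u, w) ↦ (√(1 - b²) u, w)`, which makes the flux matrix symmetric. -/
noncomputable def symMap (b : ℝ) : ℂ × ℂ →ₗ[ℝ] ModeSpace where
  toFun x := WithLp.toLp 2 ((√(1 - b ^ 2) : ℂ) * x.1, x.2)
  map_add' x y := by
    rw [← WithLp.toLp_add]
    congr 1
    ext <;> simp [mul_add]
  map_smul' c x := by
    rw [RingHom.id_apply, ← WithLp.toLp_smul]
    congr 1
    ext <;> simp [mul_left_comm]

/-- The symmetrized flux matrix, multiplied by `i`. -/
noncomputable def symFlux (b : ℝ) : ModeSpace →ₗ[ℝ] ModeSpace where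
  toFun x := WithLp.toLp 2 (Complex.I * ((b : ℂ) * x.fst + (√(1 - b ^ 2) : ℂ) * x.snd),
    Complex.I * ((√(1 - b ^ 2) : ℂ) * x.fst - (b : ℂ) * x.snd))
  map_add' x y := by
    rw [← WithLp.toLp_add]
    congr 1
    ext <;> (simp; ring)
  map_smul' c x := by
    rw [RingHom.id_apply, ← WithLp.toLp_smul]
    congr 1
    ext <;> simp <;> ring

/-- The projection to the second component. -/
noncomputable def symRelax : ModeSpace →ₗ[ℝ] ModeSpace where
  toFun x := WithLp.toLp 2 (0, x.snd)
  map_add' x y := by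
    rw [← WithLp.toLp_add]
    congr 1
    ext <;> simp
  map_smul' c x := by
    rw [RingHom.id_apply, ← WithLp.toLp_smul]
    congr 1
    ext <;> simp

/-- Conjugation by `diag(√(1 - b²), 1)` turns the flux into the symmetric matrix with rows `(b, √(1
- b²))` and `(√(1 - b²), -b)`, and leaves the relaxation unchanged. -/
theorem symFlux_symMap {b : ℝ} (hb : |b| < 1) (x : ℂ × ℂ) :
    symFlux b (symMap b x) = symMap b (Complex.I • fluxOp b x) := by
  have h1 : b ^ 2 < 1 := by rwa [sq_lt_one_iff_abs_lt_one]
  have hs : (√(1 - b ^ 2) : ℂ) * (√(1 - b ^ 2) : ℂ) = 1 - (b : ℂ) ^ 2 := by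
    rw [← Complex.ofReal_mul, Real.mul_self_sqrt (by linarith)]
    push_cast
    rfl
  simp only [symFlux, symMap, LinearMap.coe_mk, AddHom.coe_mk, fluxOp_apply]
  congr 1
  ext
  · simp
    ring
  · simp [← mul_assoc, hs]

theorem symRelax_symMap (b : ℝ) (x : ℂ × ℂ) :
    symRelax (symMap b x) = symMap b (relaxOp x) := by
  simp [symRelax, symMap, relaxOp_apply]

theorem norm_symMap_sq {b : ℝ} (hb : |b| < 1) (x : ℂ × ℂ) :
    ‖symMap b x‖ ^ 2 = modeEnergy b x := by
  have h1 : b ^ 2 < 1 := by rwa [sq_lt_one_iff_abs_lt_one]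
  rw [WithLp.prod_norm_sq_eq_of_L2]
  change ‖(√(1 - b ^ 2) : ℂ) * x.1‖ ^ 2 + ‖x.2‖ ^ 2 = (1 - b ^ 2) * ‖x.1‖ ^ 2 + ‖x.2‖ ^ 2
  rw [norm_mul, Complex.norm_real, Real.norm_of_nonneg (Real.sqrt_nonneg _), mul_pow,
    Real.sq_sqrt (by linarith)]

theorem inner_symFlux_self (b : ℝ) (x : ModeSpace) : inner ℝ x (symFlux b x) = 0 := by
  rw [WithLp.prod_inner_apply]
  simp [symFlux, Complex.inner]
  ring

/-- Equality holds: the symmetric matrix squares to `b² + (1 - b²) = 1`, the characteristic speeds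
being `±1`. -/
theorem norm_symFlux_le {b : ℝ} (hb : |b| < 1) (x : ModeSpace) : ‖symFlux b x‖ ≤ ‖x‖ := by
  have h1 : b ^ 2 < 1 := by rwa [sq_lt_one_iff_abs_lt_one]
  have hs := Real.sq_sqrt (by linarith : 0 ≤ 1 - b ^ 2)
  refine le_of_sq_le_sq (le_of_eq ?_) (norm_nonneg _)
  rw [WithLp.prod_norm_sq_eq_of_L2, WithLp.prod_norm_sq_eq_of_L2]
  simp only [Complex.sq_norm, Complex.normSq_apply]
  simp [symFlux]
  linear_combination (x.fst.re ^ 2 + x.fst.im ^ 2 + x.snd.re ^ 2 + x.snd.im ^ 2) * hs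

theorem inner_symRelax (x y : ModeSpace) :
    inner ℝ x (symRelax y) = inner ℝ (symRelax x) (symRelax y) := by
  rw [WithLp.prod_inner_apply, WithLp.prod_inner_apply]
  simp [symRelax]

/-- The residual of the exact solution in the scheme. -/
theorem exists_mode_consistency (q : ℕ) (hq1 : 1 ≤ q) (hq4 : q ≤ 4) (b : ℝ) (hb : |b| < 1) :
    ∃ C : ℝ, 0 < C ∧ ∀ (ε h a B : ℝ) (k : ℤ) (y : ℝ → ℂ × ℂ), 0 < h → 0 ≤ a →
      IsModeSolution b ε k y →
      (∀ t, a ≤ t → ‖(modeOp b ε k ^ (q + 1)) (y t)‖ ≤ B) →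
      (∀ t, a ≤ t → |(k : ℝ)| * ‖(modeOp b ε k ^ q) (y t)‖ ≤ B) →
      ‖∑ i ∈ Finset.range (q + 1), bdfAlpha q i • y (a + i * h)
        + (h * k) • ∑ i ∈ Finset.range q, bdfGamma q i • Complex.I • fluxOp b (y (a + i * h))
        + (bdfBeta q * h / ε) • relaxOp (y (a + q * h))‖ ≤ C * h ^ (q + 1) * B := by
  have hβ := bdfBeta_pos q hq1
  set C₁ := (∑ i ∈ Finset.range (q + 1), |bdfAlpha q i|) * (q : ℝ) ^ (q + 1)
          + bdfBeta q * (q : ℝ) ^ q with hC₁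
  set C₂ := ((∑ i ∈ Finset.range q, |bdfGamma q i|) + bdfBeta q) * (q : ℝ) ^ q with hC₂
  have hq0 : (0 : ℝ) < q := by exact_mod_cast hq1
  have hC₁0 : 0 < C₁ := by positivity
  have hC₂0 : 0 < C₂ := by positivity
  refine ⟨C₁ + 2 * C₂, by positivity, ?_⟩
  intro ε h a B k y hh ha hy hB1 hB2
  have hF : ∀ m, ∀ t, a ≤ t → HasDerivWithinAt (fun t => (modeOp b ε k ^ m) (y t))
      ((modeOp b ε k ^ (m + 1)) (y t)) (Set.Ici a) t := fun m t ht =>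
    (hy.hasDerivWithinAt_pow m (ha.trans ht)).mono (Set.Ici_subset_Ici.2 ha)
  have h1 := norm_bdf_defect_le q hq1 hq4 (F := fun m t => (modeOp b ε k ^ m) (y t)) hh.le hF hB1
  -- The factor `k` of `∂ₓ` is put into the extrapolated function; this is why `|k| ‖M^q y‖` has to
  -- be bounded.
  have hkF : ∀ m, ∀ t, a ≤ t →
      HasDerivWithinAt (fun t => (k : ℝ) • (modeOp b ε k ^ m) (y t))
        ((k : ℝ) • (modeOp b ε k ^ (m + 1)) (y t)) (Set.Ici a) t := fun m t ht =>
    (hF m t ht).const_smul (k : ℝ)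
  have h2 := norm_extrapolation_defect_le q hq1 hq4
    (F := fun m t => (k : ℝ) • (modeOp b ε k ^ m) (y t)) (S := B) hh.le hkF (fun t ht => by
      rw [norm_smul, Real.norm_eq_abs]
      exact hB2 t ht)
  simp only [pow_zero, pow_one, one_apply_eq_self] at h1 h2
  set D₁ := ∑ i ∈ Finset.range (q + 1), bdfAlpha q i • y (a + i * h)
    - (bdfBeta q * h) • modeOp b ε k (y (a + q * h)) with hD₁
  set D₂ := ∑ i ∈ Finset.range q, bdfGamma q i • ((k : ℝ) • y (a + i * h))
    - bdfBeta q • ((k : ℝ) • y (a + q * h)) with hD₂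
  -- At the last node the ODE replaces the derivative in `D₁` by flux and relaxation. The relaxation
  -- cancels exactly, as the scheme treats it implicitly, so no `1/ε` survives outside the
  -- derivatives.
  have hid : ∑ i ∈ Finset.range (q + 1), bdfAlpha q i • y (a + i * h)
        + (h * k) • ∑ i ∈ Finset.range q, bdfGamma q i • Complex.I • fluxOp b (y (a + i * h))
        + (bdfBeta q * h / ε) • relaxOp (y (a + q * h))
      = D₁ + h • Complex.I • fluxOp b D₂ := by
    have e1 : fluxOp b D₂ = ∑ i ∈ Finset.range q, bdfGamma q i • ((k : ℝ) • fluxOp b (y (a + i * h)))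
        - bdfBeta q • ((k : ℝ) • fluxOp b (y (a + q * h))) := by
      rw [hD₂, map_sub, map_sum]
      simp_rw [ContinuousLinearMap.map_smul_of_tower]
    have e2 : (h * k) • ∑ i ∈ Finset.range q,
          bdfGamma q i • Complex.I • fluxOp b (y (a + i * h))
        = h • Complex.I • ∑ i ∈ Finset.range q,
          bdfGamma q i • ((k : ℝ) • fluxOp b (y (a + i * h))) := by
      simp_rw [Finset.smul_sum]
      refine Finset.sum_congr rfl fun i _ => ?_
      ext <;> (simp; ring)
    rw [e1, e2, hD₁, modeOp_apply, smul_sub Complex.I, smul_sub h, smul_sub (bdfBeta q * h),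
      smul_neg]
    have e3 : (bdfBeta q * h) • (Complex.I * (k : ℂ)) • fluxOp b (y (a + q * h))
        = h • Complex.I • bdfBeta q • (k : ℝ) • fluxOp b (y (a + q * h)) := by
      ext <;> (simp; ring)
    have e4 : (bdfBeta q * h) • (1 / (ε : ℂ)) • relaxOp (y (a + q * h))
        = (bdfBeta q * h / ε) • relaxOp (y (a + q * h)) := by
      ext <;> (simp; ring)
    rw [e3, e4]
    abel
  rw [hid]
  refine (norm_add_le _ _).trans ?_
  have h3 : ‖h • Complex.I • fluxOp b D₂‖ ≤ h * (2 * (C₂ * h ^ q * B)) := by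
    rw [norm_smul, norm_smul, Complex.norm_I, one_mul, Real.norm_of_nonneg hh.le]
    gcongr
    exact (norm_fluxOp_le hb _).trans (by gcongr)
  refine (add_le_add h1 h3).trans (le_of_eq ?_)
  ring

/-- The error of the scheme on one Fourier mode, uniformly in `ε` and in the mode. -/
theorem exists_mode_error_constant (q : ℕ) (hq1 : 1 ≤ q) (hq4 : q ≤ 4) (b : ℝ) (hb : |b| < 1)
    (c : ℝ) (hc : 0 ≤ c) (T : ℝ) :
    ∃ C : ℝ, 0 < C ∧ ∀ (ε h a B : ℝ) (k : ℤ) (y : ℝ → ℂ × ℂ) (Y : ℕ → ℂ × ℂ),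
      0 < ε → 0 < h → h ≤ 1 → h * (k : ℝ) ^ 2 ≤ c → 0 ≤ a → 0 ≤ B →
      IsModeSolution b ε k y →
      (∀ t, a ≤ t → ‖(modeOp b ε k ^ (q + 1)) (y t)‖ ≤ B) →
      (∀ t, a ≤ t → |(k : ℝ)| * ‖(modeOp b ε k ^ q) (y t)‖ ≤ B) →
      (∀ i < q, Y i = y (a + i * h)) →
      (∀ n, ∑ i ∈ Finset.range (q + 1), bdfAlpha q i • Y (n + i)
        + (h * k) • ∑ i ∈ Finset.range q, bdfGamma q i • Complex.I • fluxOp b (Y (n + i))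
        + (bdfBeta q * h / ε) • relaxOp (Y (n + q)) = 0) →
      ∀ n : ℕ, n * h ≤ T → ‖y (a + n * h) - Y n‖ ^ 2 ≤ C * h ^ (2 * q) * B ^ 2 := by
  have hb1 : b ^ 2 < 1 := by rwa [sq_lt_one_iff_abs_lt_one]
  have hb2 : 0 < 1 - b ^ 2 := by linarith
  obtain ⟨C₁, hC₁, hstab⟩ := exists_stability_constant q hq1 hq4 c hc
  obtain ⟨C₂, hC₂, hcons⟩ := exists_mode_consistency q hq1 hq4 b hb
  have hβ := bdfBeta_pos q hq1
  -- The factors `2` and `1 / (1 - b²)` convert between the norm of `ℂ × ℂ` and the energy.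
  refine ⟨200 * Real.exp (C₁ * T) * (2 * C₂ ^ 2) / (1 - b ^ 2), by positivity, ?_⟩
  intro ε h a B k y Y hε hh hh1 hkh ha hB0 hy hB1 hB2 hY0 hY n hn
  set R : ℕ → ℂ × ℂ := fun n =>
    ∑ i ∈ Finset.range (q + 1), bdfAlpha q i • y (a + (n + i : ℕ) * h)
      + (h * k) • ∑ i ∈ Finset.range q,
          bdfGamma q i • Complex.I • fluxOp b (y (a + (n + i : ℕ) * h))
      + (bdfBeta q * h / ε) • relaxOp (y (a + (n + q : ℕ) * h)) with hR
  have hRle : ∀ n, ‖R n‖ ≤ C₂ * h ^ (q + 1) * B := by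
    intro n
    have han : a ≤ a + n * h := by nlinarith [n.cast_nonneg (α := ℝ)]
    have h1 := hcons ε h (a + n * h) B k y hh (ha.trans han) hy
      (fun t ht => hB1 t (han.trans ht)) fun t ht => hB2 t (han.trans ht)
    have hshift : ∀ i : ℕ, a + (n + i : ℕ) * h = a + n * h + i * h := fun i => by
      push_cast
      ring
    simp only [hR, hshift]
    exact h1
  set e : ℕ → ℂ × ℂ := fun n => y (a + n * h) - Y n with he
  have hrec : ∀ n, ∑ i ∈ Finset.range (q + 1), bdfAlpha q i • e (n + i)
        + (h * k) • ∑ i ∈ Finset.range q, bdfGamma q i • Complex.I • fluxOp b (e (n + i))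
        + (bdfBeta q * h / ε) • relaxOp (e (n + q)) = R n := by
    intro n
    have h1 : R n - 0 = R n := sub_zero _
    rw [← h1, ← hY n]
    simp only [hR, he, map_sub, smul_sub, Finset.sum_sub_distrib]
    abel
  -- The CFL condition enters here as `(h k)² = h (h k²) ≤ c h`.
  have hS := hstab ModeSpace (symFlux b) symRelax (inner_symFlux_self b) (norm_symFlux_le hb)
    inner_symRelax h (h * k) (bdfBeta q * h / ε) (2 * (C₂ * h ^ q * B) ^ 2) hh.le hh1
    (by nlinarith) (by positivity) (by positivity) (fun n => symMap b (e n))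
    (fun n => symMap b (R n)) (fun i hi => by simp [he, hY0 i hi]) (fun n => by
      rw [norm_symMap_sq hb]
      refine (modeEnergy_le b _).trans ?_
      have h1 : ‖R n‖ ^ 2 ≤ (C₂ * h ^ (q + 1) * B) ^ 2 := by
        gcongr
        exact hRle n
      refine (mul_le_mul_of_nonneg_left h1 zero_le_two).trans (le_of_eq ?_)
      ring) (fun n => by
      rw [← hrec n]
      simp only [map_add, map_smul, map_sum, symFlux_symMap hb, symRelax_symMap]) n
  rw [norm_symMap_sq hb] at hS
  have h1 := (norm_sq_le_modeEnergy hb (e n)).trans hS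
  have h2 : Real.exp (C₁ * (n * h)) ≤ Real.exp (C₁ * T) := by gcongr
  have h3 : (1 - b ^ 2) * ‖e n‖ ^ 2
      ≤ 200 * (Real.exp (C₁ * T) * (2 * (C₂ * h ^ q * B) ^ 2)) := h1.trans (by gcongr)
  have h4 : ‖e n‖ ^ 2 ≤ 200 * (Real.exp (C₁ * T) * (2 * (C₂ * h ^ q * B) ^ 2)) / (1 - b ^ 2) := by
    rw [le_div_iff₀ hb2]
    linarith
  refine h4.trans (le_of_eq ?_)
  rw [pow_mul']
  ring

/-! ### Decay of the initial layer -/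

theorem norm_le_exp_mul_of_hasDerivWithinAt {p : ℝ → ℂ × ℂ} {μ : ℂ}
    (hp : ∀ t, 0 ≤ t → HasDerivWithinAt p (μ • p t) (Set.Ici 0) t) {t : ℝ} (ht : 0 ≤ t) :
    ‖p t‖ ≤ Real.exp (μ.re * t) * ‖p 0‖ := by
  have hder : ∀ x, 0 ≤ x →
      HasDerivWithinAt (fun s : ℝ => Complex.exp (-μ * s) • p s) 0 (Set.Ici 0) x := by
    intro x hx
    have h1 : HasDerivAt (fun s : ℝ => Complex.exp (-μ * s)) (Complex.exp (-μ * x) * (-μ)) x := by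
      have h2 := ((hasDerivAt_id (x : ℂ)).const_mul (-μ)).cexp.comp_ofReal
      simpa using h2
    refine (h1.hasDerivWithinAt.smul (hp x hx)).congr_deriv ?_
    rw [smul_smul, ← add_smul]
    simp
  have h1 := constant_of_has_deriv_right_zero (a := 0) (b := t)
    (fun x hx => ((hder x hx.1).continuousWithinAt).mono Set.Icc_subset_Ici_self)
    (fun x hx => (hder x hx.1).mono (Set.Ici_subset_Ici.2 hx.1)) t ⟨ht, le_rfl⟩
  simp only [Complex.ofReal_zero, mul_zero, Complex.exp_zero, one_smul] at h1
  have h2 : p t = Complex.exp (μ * t) • p 0 := by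
    rw [← h1, smul_smul, ← Complex.exp_add]
    simp
  rw [h2, norm_smul, Complex.norm_exp]
  simp

/-- The characteristic equation of the generator. -/
theorem modeOp_modeOp (b ε : ℝ) (k : ℤ) (x : ℂ × ℂ) :
    modeOp b ε k (modeOp b ε k x)
      = -((1 / (ε : ℂ)) • modeOp b ε k x)
        - ((k : ℂ) ^ 2 + Complex.I * k * b * (1 / (ε : ℂ))) • x := by
  have hI := Complex.I_sq
  simp only [modeOp_apply, fluxOp_apply, relaxOp_apply]
  ext
  · simp
    linear_combination (k : ℂ) ^ 2 * x.1 * hI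
  · simp
    linear_combination (k : ℂ) ^ 2 * x.2 * hI

/-- The eigenvalues of the generator in the stiff regime: `μ₁` is fast and `μ₂` is slow. -/
theorem exists_eigenvalues {b ε : ℝ} (hb : |b| < 1) {k : ℤ}
    (h : 4 * (1 + |(k : ℝ)|) < 1 / ε) :
    ∃ μ₁ μ₂ : ℂ, μ₁ + μ₂ = -(1 / (ε : ℂ)) ∧
      μ₁ * μ₂ = (k : ℂ) ^ 2 + Complex.I * k * b * (1 / (ε : ℂ)) ∧
      μ₁.re ≤ -(9 / 10) * (1 / ε) ∧ 1 / 2 * (1 / ε) ≤ ‖μ₁ - μ₂‖ ∧ ‖μ₁‖ ≤ 2 * (1 / ε) ∧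
      ‖μ₂‖ ≤ 2 * (1 + |(k : ℝ)|) := by
  have hs' : (1 / (ε : ℂ)) = ((1 / ε : ℝ) : ℂ) := by push_cast; rfl
  rw [hs']
  set s := 1 / ε with hs
  have hk0 := abs_nonneg (k : ℝ)
  have hs0 : 0 < s := by linarith
  -- A square root of the discriminant; the sign with `0 ≤ r.re` makes `(-s - r) / 2` the fast
  -- eigenvalue.
  obtain ⟨r, hr, hr0⟩ : ∃ r : ℂ,
      r ^ 2 = (s : ℂ) ^ 2 - 4 * ((k : ℂ) ^ 2 + Complex.I * k * b * s) ∧ 0 ≤ r.re := by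
    obtain ⟨r, hr⟩ := IsAlgClosed.exists_pow_nat_eq
      ((s : ℂ) ^ 2 - 4 * ((k : ℂ) ^ 2 + Complex.I * k * b * s)) two_pos
    rcases le_total 0 r.re with h0 | h0
    · exact ⟨r, hr, h0⟩
    · exact ⟨-r, by rw [neg_sq, hr], by simpa using h0⟩
  have hksq : (k : ℝ) ^ 2 ≤ s ^ 2 / 16 := by
    rw [← sq_abs]
    nlinarith
  have hre : r.re ^ 2 - r.im ^ 2 = s ^ 2 - 4 * (k : ℝ) ^ 2 := by
    have := congrArg Complex.re hr
    simp [pow_two] at this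
    linarith
  -- `r.re² ≥ s² - 4k² ≥ (3/4) s²`, which exceeds `(4/5)² s²`; hence the `9/10` in the fast decay
  -- rate.
  have hrre : 4 / 5 * s ≤ r.re := by
    refine le_of_sq_le_sq ?_ hr0
    nlinarith [sq_nonneg r.im]
  have hprod : ‖(k : ℂ) ^ 2 + Complex.I * k * b * s‖ ≤ 5 / 4 * |(k : ℝ)| * s := by
    refine (norm_add_le _ _).trans ?_
    rw [norm_pow, norm_mul, norm_mul, norm_mul, Complex.norm_I, one_mul, Complex.norm_intCast,
      Complex.norm_real, Complex.norm_real, Real.norm_eq_abs, Real.norm_eq_abs, abs_of_pos hs0]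
    have h1 : |(k : ℝ)| * |b| * s ≤ |(k : ℝ)| * 1 * s := by gcongr
    nlinarith
  have hrn : ‖r‖ ≤ 2 * s := by
    refine le_of_sq_le_sq ?_ (by positivity)
    rw [← norm_pow, hr]
    refine (norm_sub_le _ _).trans ?_
    rw [norm_mul, norm_pow, Complex.norm_real, Real.norm_of_nonneg hs0.le]
    have h4 : ‖(4 : ℂ)‖ = 4 := by simp
    rw [h4]
    nlinarith
  have h1re : ((-(s : ℂ) - r) / 2).re = (-s - r.re) / 2 := by simp
  have h12 : (-(s : ℂ) - r) / 2 * ((-(s : ℂ) + r) / 2)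
      = (k : ℂ) ^ 2 + Complex.I * k * b * s := by
    linear_combination -(1 / 4 : ℂ) * hr
  refine ⟨(-(s : ℂ) - r) / 2, (-(s : ℂ) + r) / 2, by ring, h12, ?_, ?_, ?_, ?_⟩
  · rw [h1re]
    linarith
  · rw [show (-(s : ℂ) - r) / 2 - (-(s : ℂ) + r) / 2 = -r by ring, norm_neg]
    linarith [Complex.re_le_norm r]
  · rw [norm_div, Complex.norm_ofNat]
    have h1 := norm_sub_le (-(s : ℂ)) r
    rw [norm_neg, Complex.norm_real, Real.norm_of_nonneg hs0.le] at h1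
    linarith
  -- The slow eigenvalue is a difference of large numbers, so it is bounded as the product of the
  -- eigenvalues divided by the fast one.
  · have h1 : 9 / 10 * s ≤ ‖(-(s : ℂ) - r) / 2‖ := by
      have h2 := Complex.abs_re_le_norm ((-(s : ℂ) - r) / 2)
      rw [h1re] at h2
      linarith [neg_le_abs ((-s - r.re) / 2)]
    have h3 : ‖(-(s : ℂ) - r) / 2‖ * ‖(-(s : ℂ) + r) / 2‖ ≤ 5 / 4 * |(k : ℝ)| * s := by
      rwa [← norm_mul, h12]
    have h4 : 9 / 10 * s * ‖(-(s : ℂ) + r) / 2‖ ≤ 5 / 4 * |(k : ℝ)| * s :=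
      le_trans (by gcongr) h3
    have h5 : 9 / 10 * ‖(-(s : ℂ) + r) / 2‖ ≤ 5 / 4 * |(k : ℝ)| := by
      refine le_of_mul_le_mul_right ?_ hs0
      linarith
    linarith

theorem modeOp_pow_eigen {b ε : ℝ} {k : ℤ} {μ : ℂ} {p : ℂ × ℂ} (hp : modeOp b ε k p = μ • p)
    (m : ℕ) : (modeOp b ε k ^ m) p = μ ^ m • p := by
  induction m with
  | zero => simp
  | succ m ih =>
    rw [pow_succ, mul_apply_eq_comp, hp, map_smul, ih, smul_smul, pow_succ, mul_comm]

theorem norm_modeOp_pow_le {b ε : ℝ} {k : ℤ} {L : ℝ} (hL0 : 0 ≤ L)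
    (hL : ∀ x, ‖modeOp b ε k x‖ ≤ L * ‖x‖) (m : ℕ) (x : ℂ × ℂ) :
    ‖(modeOp b ε k ^ m) x‖ ≤ L ^ m * ‖x‖ := by
  induction m with
  | zero => simp
  | succ m ih =>
    rw [pow_succ', mul_apply_eq_comp]
    refine (hL _).trans ?_
    rw [pow_succ', mul_assoc]
    gcongr

/-- After the initial layer the time derivatives are bounded uniformly in `ε`: the stiff
regime. -/
theorem norm_modeOp_pow_le_of_stiff {q : ℕ} (hq4 : q ≤ 4) {b : ℝ} (hb : |b| < 1) {ε a : ℝ} {k : ℤ}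
    {y : ℝ → ℂ × ℂ} (hε : 0 < ε) (ha : 0 ≤ a) (hy : IsModeSolution b ε k y)
    (hlog : ((q : ℝ) + 2) * ε * Real.log (1 / ε) ≤ a) (hk : 4 * (1 + |(k : ℝ)|) < 1 / ε)
    {m : ℕ} (hm : m ≤ q + 1) {t : ℝ} (ht : a ≤ t) :
    ‖(modeOp b ε k ^ m) (y t)‖
      ≤ 8 * 2 ^ m * (√(2 / (1 - b ^ 2)) + 1) * (1 + |(k : ℝ)|) ^ m * ‖y 0‖ := by
  obtain ⟨μ₁, μ₂, hsum, hprod, hre, hdiff, hμ₁, hμ₂⟩ := exists_eigenvalues hb hk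
  have hMM := modeOp_modeOp b ε k
  rw [← hprod] at hMM
  simp_rw [← neg_smul, ← hsum] at hMM
  have hk0 := abs_nonneg (k : ℝ)
  have hM := norm_modeOp_le hb hε k
  set s := 1 / ε with hs
  have hs1 : 1 ≤ s := by linarith
  have hs0 : 0 < s := by linarith
  set M := modeOp b ε k with hMdef
  set κ := √(2 / (1 - b ^ 2)) with hκ
  have hκ0 : 0 ≤ κ := Real.sqrt_nonneg _
  have ht0 : 0 ≤ t := ha.trans ht
  -- By Cayley–Hamilton `(M - ν) x` is either zero or an eigenvector for `μ`: unnormalized spectral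
  -- projections.
  have key : ∀ μ ν : ℂ, (∀ x, M (M x) = (μ + ν) • M x - (μ * ν) • x) → ∀ x,
      M (M x - ν • x) = μ • (M x - ν • x) := by
    intro μ ν h x
    rw [map_sub, map_smul, h]
    module
  have hM1 := key μ₁ μ₂ hMM
  have hM2 := key μ₂ μ₁ (fun x => by rw [add_comm μ₂, mul_comm μ₂]; exact hMM x)
  have hder (ν : ℂ) : IsModeSolution b ε k fun t => M (y t) - ν • y t := by
    refine hy.comp (B := M - ν • (1 : ℂ × ℂ →L[ℂ] ℂ × ℂ)) (ContinuousLinearMap.ext fun x => ?_)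
    change M (M x) - ν • M x = M (M x - ν • x)
    rw [map_sub, map_smul]
  have hinit : ∀ ν : ℂ, ‖ν‖ ≤ 2 * s → ‖M (y 0) - ν • y 0‖ ≤ 4 * s * ‖y 0‖ := by
    intro ν hν
    refine (norm_sub_le _ _).trans ?_
    rw [norm_smul]
    have h1 : ‖ν‖ * ‖y 0‖ ≤ 2 * s * ‖y 0‖ := by gcongr
    have h2 : (2 * |(k : ℝ)| + s) * ‖y 0‖ ≤ (2 * s) * ‖y 0‖ := by
      gcongr
      linarith
    linarith [hM (y 0)]
  have hp1 : ‖M (y t) - μ₂ • y t‖ ≤ 1 / s ^ (q + 1) * (4 * s * ‖y 0‖) := by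
    have h1 := norm_le_exp_mul_of_hasDerivWithinAt (p := fun t => M (y t) - μ₂ • y t) (μ := μ₁)
      (fun t ht => (hder μ₂ t ht).congr_deriv (hM1 _)) ht0
    refine h1.trans ?_
    have hlog0 : 0 ≤ Real.log s := Real.log_nonneg hs1
    have h2 : ((q : ℝ) + 2) * Real.log s ≤ s * t := by
      have h3 : ((q : ℝ) + 2) * ε * Real.log s ≤ t := hlog.trans ht
      have h4 : ε * s = 1 := by rw [hs]; field_simp
      calc ((q : ℝ) + 2) * Real.log s = s * (((q : ℝ) + 2) * ε * Real.log s) := by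
            linear_combination -((q : ℝ) + 2) * Real.log s * h4
        _ ≤ s * t := by gcongr
    have hq : (q : ℝ) ≤ 4 := by exact_mod_cast hq4
    have h3 : μ₁.re * t ≤ -(((q + 1 : ℕ) : ℝ) * Real.log s) := by
      push_cast
      have h5 : μ₁.re * t ≤ -(9 / 10) * s * t := by gcongr
      -- `(9/10)(q + 2) - (q + 1) = (8 - q)/10`: the spare unit in the waiting time `q + 2` pays for
      -- the rate `9/10`.
      have h6 : 0 ≤ (8 - (q : ℝ)) * Real.log s := mul_nonneg (by linarith) hlog0
      linarith
    have h4 : Real.exp (μ₁.re * t) ≤ 1 / s ^ (q + 1) := by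
      refine (Real.exp_le_exp.2 h3).trans (le_of_eq ?_)
      rw [Real.exp_neg, Real.exp_nat_mul, Real.exp_log hs0, one_div]
    have h5 := hinit μ₂ (by linarith)
    gcongr
  have hp2 : ‖M (y t) - μ₁ • y t‖ ≤ κ * (4 * s * ‖y 0‖) := by
    refine ((hder μ₁).norm_le hε hb le_rfl ht0).trans ?_
    have h5 := hinit μ₁ hμ₁
    gcongr
  -- The fast part is multiplied by `μ₁^m = O(s^m)`, offset by the decay `s^(-(q+1))`; the slow part
  -- only by `μ₂^m = O((1 + |k|)^m)`. The size `4s` of the initial components cancels against `‖μ₁ -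
  -- μ₂‖ ≥ s/2`, whence the factor `8`.
  have hid : (μ₁ - μ₂) • (M ^ m) (y t)
      = μ₁ ^ m • (M (y t) - μ₂ • y t) - μ₂ ^ m • (M (y t) - μ₁ • y t) := by
    rw [← modeOp_pow_eigen (hM1 (y t)) m, ← modeOp_pow_eigen (hM2 (y t)) m, ← map_sub, ← map_smul]
    congr 1
    module
  have h1 : ‖μ₁ - μ₂‖ * ‖(M ^ m) (y t)‖
      ≤ (2 * s) ^ m * (1 / s ^ (q + 1) * (4 * s * ‖y 0‖))
        + (2 * (1 + |(k : ℝ)|)) ^ m * (κ * (4 * s * ‖y 0‖)) := by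
    rw [← norm_smul, hid]
    refine (norm_sub_le _ _).trans ?_
    rw [norm_smul, norm_smul, norm_pow, norm_pow]
    gcongr
  have h2 : (2 * s) ^ m * (1 / s ^ (q + 1)) ≤ 2 ^ m * (1 + |(k : ℝ)|) ^ m := by
    rw [mul_pow, mul_assoc]
    gcongr
    have h3 : s ^ m * (1 / s ^ (q + 1)) ≤ 1 := by
      rw [mul_one_div, div_le_one (by positivity)]
      exact pow_le_pow_right₀ hs1 hm
    exact h3.trans (one_le_pow₀ (by linarith))
  have h3 : 1 / 2 * s * ‖(M ^ m) (y t)‖ ≤ ‖μ₁ - μ₂‖ * ‖(M ^ m) (y t)‖ := by gcongr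
  have h4 : (2 * s) ^ m * (1 / s ^ (q + 1) * (4 * s * ‖y 0‖))
      ≤ 2 ^ m * (1 + |(k : ℝ)|) ^ m * (4 * s * ‖y 0‖) := by
    rw [← mul_assoc]
    gcongr
  rw [mul_pow 2 (1 + |(k : ℝ)|)] at h1
  refine le_of_mul_le_mul_left ?_ (by linarith : 0 < 1 / 2 * s)
  linarith

/-- After the initial layer the time derivatives are bounded uniformly in `ε`. -/
theorem exists_layer_constant (q : ℕ) (hq4 : q ≤ 4) (b : ℝ) (hb : |b| < 1) :
    ∃ C : ℝ, 0 < C ∧ ∀ (ε a : ℝ) (k : ℤ) (y : ℝ → ℂ × ℂ), 0 < ε → 0 ≤ a →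
      IsModeSolution b ε k y → ((q : ℝ) + 2) * ε * Real.log (1 / ε) ≤ a →
      ∀ m ≤ q + 1, ∀ t, a ≤ t →
        ‖(modeOp b ε k ^ m) (y t)‖ ≤ C * (1 + |(k : ℝ)|) ^ m * ‖y 0‖ := by
  set κ := √(2 / (1 - b ^ 2)) with hκ
  have hκ0 : 0 ≤ κ := Real.sqrt_nonneg _
  refine ⟨8 * 6 ^ (q + 1) * (κ + 1), by positivity, ?_⟩
  intro ε a k y hε ha hy hlog m hm t ht
  have hk0 := abs_nonneg (k : ℝ)
  -- In the non-stiff case `2|k| + 1/ε ≤ 6(1 + |k|)` bounds the generator directly and no waiting is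
  -- needed.
  rcases le_or_gt (1 / ε) (4 * (1 + |(k : ℝ)|)) with h | h
  · have h1 := norm_modeOp_pow_le (L := 6 * (1 + |(k : ℝ)|)) (by positivity)
      (fun x => (norm_modeOp_le hb hε k x).trans (by gcongr; linarith)) m (y t)
    have h2 := hy.norm_le hε hb le_rfl (ha.trans ht)
    rw [mul_pow] at h1
    have h3 : (6 : ℝ) ^ m ≤ 6 ^ (q + 1) := pow_le_pow_right₀ (by norm_num) hm
    calc ‖(modeOp b ε k ^ m) (y t)‖ ≤ 6 ^ m * (1 + |(k : ℝ)|) ^ m * ‖y t‖ := h1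
      _ ≤ 6 ^ (q + 1) * (1 + |(k : ℝ)|) ^ m * (κ * ‖y 0‖) := by gcongr
      _ = 6 ^ (q + 1) * κ * (1 + |(k : ℝ)|) ^ m * ‖y 0‖ := by ring
      _ ≤ 8 * 6 ^ (q + 1) * (κ + 1) * (1 + |(k : ℝ)|) ^ m * ‖y 0‖ := by
        gcongr
        · have : (0 : ℝ) < 6 ^ (q + 1) := by positivity
          linarith
        · linarith
  · refine (norm_modeOp_pow_le_of_stiff hq4 hb hε ha hy hlog h hm ht).trans ?_
    have h3 : (2 : ℝ) ^ m ≤ 6 ^ (q + 1) :=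
      (pow_le_pow_left₀ (by norm_num) (by norm_num) m).trans (pow_le_pow_right₀ (by norm_num) hm)
    gcongr

/-! ### Fourier coefficients -/

/-- The `k`-th Fourier coefficient as a continuous linear functional. -/
noncomputable def coeffL (k : ℤ) : L2 →L[ℂ] ℂ := innerSL ℂ (fourierLp 2 k : L2)

theorem coeffL_apply (k : ℤ) (f : L2) : coeffL k f = fourierCoeff (f : Torus → ℂ) k := by
  rw [← fourierBasis_repr, HilbertBasis.repr_apply_apply, coe_fourierBasis]
  rfl

theorem hasSum_sq_coeffL (f : L2) : HasSum (fun k => ‖coeffL k f‖ ^ 2) (‖f‖ ^ 2) := by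
  simp_rw [coeffL_apply, ← fourierBasis_repr]
  have h1 : HasSum (fun i => ‖fourierBasis.repr f i‖ ^ 2) (‖fourierBasis.repr f‖ ^ 2) := by
    apply_mod_cast lp.hasSum_norm ?_ (fourierBasis.repr f)
    simp
  rwa [LinearIsometryEquiv.norm_map] at h1

theorem coeffL_fourierLp (k j : ℤ) : coeffL k (fourierLp 2 j : L2) = if k = j then 1 else 0 :=
  orthonormal_iff_ite.1 (orthonormal_fourier (T := 2 * pi)) k j

theorem coeffL_sum (k : ℤ) (S : Finset ℤ) (c : ℤ → ℂ) :
    coeffL k (∑ j ∈ S, c j • (fourierLp 2 j : L2)) = if k ∈ S then c k else 0 := by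
  simp [map_sum, coeffL_fourierLp]

theorem coeffL_proj (N : ℕ) (k : ℤ) (f : L2) :
    coeffL k (proj N f) = if k ∈ Finset.Icc (-(N : ℤ)) N then coeffL k f else 0 := by
  rw [proj, coeffL_sum, coeffL_apply]

theorem coeffL_trigDeriv {N : ℕ} {k : ℤ} (hk : k ∈ Finset.Icc (-(N : ℤ)) N) (f : L2) :
    coeffL k (trigDeriv N f) = Complex.I * k * coeffL k f := by
  rw [trigDeriv, coeffL_sum, if_pos hk, coeffL_apply]

theorem coeffL_of_mem_trigPoly {N : ℕ} {k : ℤ} (hk : k ∉ Finset.Icc (-(N : ℤ)) N) {f : L2}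
    (hf : f ∈ trigPoly N) : coeffL k f = 0 := by
  have h : trigPoly N ≤ LinearMap.ker (coeffL k).toLinearMap := by
    refine Submodule.span_le.2 ?_
    rintro _ ⟨j, hj, rfl⟩
    have hkj : k ≠ j := fun h => hk (by rw [h]; simpa using hj)
    simpa [hkj] using coeffL_fourierLp k j
  exact h hf

theorem integrable_coe (f : L2) :
    MeasureTheory.Integrable (f : Torus → ℂ) (AddCircle.haarAddCircle (T := 2 * pi)) :=
  (MeasureTheory.Lp.memLp f).integrable (by norm_num)

theorem intervalIntegral_mul_fourier (g : Torus → ℂ) (k : ℤ) :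
    ∫ x in (0 : ℝ)..(2 * pi), g (x : Torus) * fourier (-k) (x : Torus)
      = 2 * pi * fourierCoeff g k := by
  have hpi : (pi : ℂ) ≠ 0 := by exact_mod_cast Real.pi_ne_zero
  rw [fourierCoeff_eq_intervalIntegral g k 0, zero_add]
  simp_rw [smul_eq_mul, mul_comm (g _)]
  rw [Complex.real_smul]
  push_cast
  field_simp

theorem contDiff_fourier (k : ℤ) :
    ContDiff ℝ (⊤ : ℕ∞) fun x : ℝ => fourier k (x : Torus) := by
  simp_rw [fourier_coe_apply]
  have : ContDiff ℝ (⊤ : ℕ∞) fun x : ℝ => (x : ℂ) := Complex.ofRealCLM.contDiff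
  fun_prop

theorem periodic_fourier (k : ℤ) :
    Function.Periodic (fun x : ℝ => fourier k (x : Torus)) (2 * pi) := fun x => by
  simp only [AddCircle.coe_add_period]

theorem deriv_fourier_neg (k : ℤ) (x : ℝ) :
    deriv (fun x : ℝ => fourier (-k) (x : Torus)) x
      = -(Complex.I * k) * fourier (-k) (x : Torus) := by
  have hpi : (pi : ℂ) ≠ 0 := by exact_mod_cast Real.pi_ne_zero
  rw [(hasDerivAt_fourier_neg (2 * pi) k x).deriv]
  push_cast
  field_simp

theorem fourierCoeff_linear (c d : ℂ) (f g : L2) (k : ℤ) :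
    fourierCoeff (fun x : Torus => c * (f : Torus → ℂ) x + d * (g : Torus → ℂ) x) k
      = c * coeffL k f + d * coeffL k g := by
  have h := fourierCoeff.add ((integrable_coe f).const_mul c) ((integrable_coe g).const_mul d)
  have h' := congrFun h k
  rw [Pi.add_apply, fourierCoeff.const_mul, fourierCoeff.const_mul] at h'
  rw [coeffL_apply, coeffL_apply]
  exact h'

/-- The `k`-th Fourier coefficients of a curve `(u, w)`. -/
noncomputable def modeCurve (u w : ℝ → L2) (k : ℤ) (t : ℝ) : ℂ × ℂ :=
  (coeffL k (u t), coeffL k (w t))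

theorem hasDerivWithinAt_of_const_mul {f : ℝ → ℂ} {f' c : ℂ} {s : Set ℝ} {t : ℝ} (hc : c ≠ 0)
    (h : HasDerivWithinAt (fun x => c * f x) (c * f') s t) : HasDerivWithinAt f f' s t := by
  have h1 := h.const_mul c⁻¹
  simpa [← mul_assoc, inv_mul_cancel₀ hc] using h1

theorem modeOp_apply_components (b ε : ℝ) (k : ℤ) (x : ℂ × ℂ) :
    modeOp b ε k x = (-(Complex.I * k) * (b * x.1 + x.2),
      -(Complex.I * k) * ((1 - (b : ℂ) ^ 2) * x.1 - b * x.2) - 1 / (ε : ℂ) * x.2) := by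
  rw [modeOp_apply, fluxOp_apply, relaxOp_apply]
  ext <;> simp

/-- Test the weak equations with `e^{-ikx}`; its derivative supplies the factor `-ik`, and the
common factor `2π` cancels. -/
theorem IsSolution.isModeSolution {b ε : ℝ} {u w : ℝ → L2} (h : IsSolution b ε u w) (k : ℤ) :
    IsModeSolution b ε k (modeCurve u w k) := by
  intro t ht
  have hpi : (2 * pi : ℂ) ≠ 0 := by
    exact_mod_cast (Real.two_pi_pos).ne'
  have hu := h.eq_u _ (contDiff_fourier (-k)) (periodic_fourier (-k)) t ht
  have hw := h.eq_w _ (contDiff_fourier (-k)) (periodic_fourier (-k)) t ht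
  simp_rw [intervalIntegral_mul_fourier, deriv_fourier_neg] at hu hw
  rw [modeOp_apply_components]
  refine HasDerivWithinAt.prodMk (hasDerivWithinAt_of_const_mul hpi ?_)
    (hasDerivWithinAt_of_const_mul hpi ?_)
  · simp_rw [coeffL_apply]
    refine hu.congr_deriv ?_
    have h1 := intervalIntegral_mul_fourier (fun x : Torus =>
      (b : ℂ) * (u t : Torus → ℂ) x + 1 * (w t : Torus → ℂ) x) k
    rw [fourierCoeff_linear] at h1
    simp_rw [one_mul] at h1
    simp_rw [mul_left_comm _ (-(Complex.I * (k : ℂ)))]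
    rw [intervalIntegral.integral_const_mul, h1, modeCurve]
  · simp_rw [coeffL_apply]
    refine hw.congr_deriv ?_
    have h1 := intervalIntegral_mul_fourier (fun x : Torus =>
      (1 - (b : ℂ) ^ 2) * (u t : Torus → ℂ) x + (-(b : ℂ)) * (w t : Torus → ℂ) x) k
    rw [fourierCoeff_linear] at h1
    simp_rw [neg_mul, ← sub_eq_add_neg] at h1
    simp_rw [mul_left_comm _ (-(Complex.I * (k : ℂ)))]
    rw [intervalIntegral.integral_const_mul, h1, ← coeffL_apply, modeCurve]
    ring

theorem hasDerivWithinAt_iteratedDerivWithin {n m : ℕ} (hm : m < n) {u : ℝ → L2}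
    (hu : ContDiffOn ℝ (n : WithTop ℕ∞) u (Set.Ici 0)) {t : ℝ} (ht : 0 ≤ t) :
    HasDerivWithinAt (iteratedDerivWithin m u (Set.Ici 0))
      (iteratedDerivWithin (m + 1) u (Set.Ici 0) t) (Set.Ici 0) t := by
  rw [iteratedDerivWithin_succ]
  exact ((hu.differentiableOn_iteratedDerivWithin (by exact_mod_cast hm)
    (uniqueDiffOn_Ici 0)) t ht).hasDerivWithinAt

/-- Time derivatives of a solution act on the Fourier coefficients as powers of the generator. -/
theorem IsSolution.modeOp_pow_modeCurve {b ε : ℝ} {u w : ℝ → L2} (h : IsSolution b ε u w)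
    {n : ℕ} (hu : ContDiffOn ℝ (n : WithTop ℕ∞) u (Set.Ici 0))
    (hw : ContDiffOn ℝ (n : WithTop ℕ∞) w (Set.Ici 0)) (k : ℤ) {m : ℕ} (hm : m ≤ n) {t : ℝ}
    (ht : 0 ≤ t) :
    (modeOp b ε k ^ m) (modeCurve u w k t)
      = (coeffL k (iteratedDerivWithin m u (Set.Ici 0) t),
          coeffL k (iteratedDerivWithin m w (Set.Ici 0) t)) := by
  induction m generalizing t with
  | zero => simp [modeCurve]
  | succ m ih =>
    have h1 := (h.isModeSolution k).hasDerivWithinAt_pow m ht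
    have h2 (v : ℝ → L2) (hv : ContDiffOn ℝ (n : WithTop ℕ∞) v (Set.Ici 0)) :
        HasDerivWithinAt (fun t => coeffL k (iteratedDerivWithin m v (Set.Ici 0) t))
          (coeffL k (iteratedDerivWithin (m + 1) v (Set.Ici 0) t)) (Set.Ici 0) t :=
      ((coeffL k).restrictScalars ℝ).hasFDerivAt.comp_hasDerivWithinAt t
        (hasDerivWithinAt_iteratedDerivWithin (by omega) hv ht)
    exact (uniqueDiffOn_Ici (0 : ℝ) t ht).eq_deriv _ h1 (((h2 u hu).prodMk (h2 w hw)).congr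
      (fun s hs => ih (by omega) hs) (ih (by omega) ht))

theorem sobolevNorm_sq (s : ℕ) (f : L2) :
    sobolevNorm s f ^ 2 = ∑' k : ℤ, ENNReal.ofReal ((1 + (k : ℝ) ^ 2) ^ s * ‖coeffL k f‖ ^ 2) := by
  simp_rw [coeffL_apply]
  rw [sobolevNorm, ← ENNReal.rpow_natCast, ← ENNReal.rpow_mul]
  norm_num

theorem sum_le_of_sobolevNorm_sq_le {s : ℕ} {f : L2} {R : ℝ≥0} (h : sobolevNorm s f ^ 2 ≤ R)
    (S : Finset ℤ) : ∑ k ∈ S, (1 + (k : ℝ) ^ 2) ^ s * ‖coeffL k f‖ ^ 2 ≤ (R : ℝ) := by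
  rw [sobolevNorm_sq] at h
  have h1 := (ENNReal.sum_le_tsum S).trans h
  rw [← ENNReal.ofReal_sum_of_nonneg fun _ _ => by positivity, ← ENNReal.ofReal_coe_nnreal] at h1
  exact (ENNReal.ofReal_le_ofReal_iff R.coe_nonneg).1 h1

theorem norm_prod_sq_le (x : ℂ × ℂ) : ‖x‖ ^ 2 ≤ ‖x.1‖ ^ 2 + ‖x.2‖ ^ 2 := by
  rcases max_choice ‖x.1‖ ‖x.2‖ with h | h <;> rw [Prod.norm_def, h] <;>
  nlinarith [sq_nonneg ‖x.1‖, sq_nonneg ‖x.2‖]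

/-! ### Regularity of well-prepared solutions -/

/-- The bound on the time derivatives of a well-prepared solution, mode by mode. -/
def IsModeBound (q : ℕ) (b ε T₀ R : ℝ) (u w : ℝ → L2) (B : ℤ → ℝ) : Prop :=
  (∀ k, 0 ≤ B k) ∧
  (∀ (k : ℤ) (t : ℝ), T₀ ≤ t → ‖(modeOp b ε k ^ (q + 1)) (modeCurve u w k t)‖ ≤ B k) ∧
  (∀ (k : ℤ) (t : ℝ), T₀ ≤ t → |(k : ℝ)| * ‖(modeOp b ε k ^ q) (modeCurve u w k t)‖ ≤ B k) ∧
  ∀ S : Finset ℤ, ∑ k ∈ S, B k ^ 2 ≤ R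

theorem exists_modeBound_of_consistent (q : ℕ) (b : ℝ) (hb : |b| < 1) (K : ℝ≥0) :
    ∃ R : ℝ, 0 ≤ R ∧ ∀ (ε T₀ : ℝ) (u w : ℝ → L2), 0 < ε → 0 ≤ T₀ → IsSolution b ε u w →
      ConsistentData q K u w → ∃ B, IsModeBound q b ε T₀ R u w B := by
  set κ := √(2 / (1 - b ^ 2)) with hκ
  have hκ0 : 0 ≤ κ := Real.sqrt_nonneg _
  refine ⟨8 * κ ^ 2 * (K : ℝ) ^ 2, by positivity, ?_⟩
  intro ε T₀ u w hε hT₀ hsol hdata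
  have hpow : ∀ m ≤ q + 1, ∀ k, (modeOp b ε k ^ m) (modeCurve u w k 0)
      = (coeffL k (timeDerivZero m u), coeffL k (timeDerivZero m w)) := fun m hm k =>
    hsol.modeOp_pow_modeCurve hdata.contDiff_u hdata.contDiff_w k hm le_rfl
  have hgrow : ∀ m k t, T₀ ≤ t → ‖(modeOp b ε k ^ m) (modeCurve u w k t)‖
      ≤ κ * ‖(modeOp b ε k ^ m) (modeCurve u w k 0)‖ := fun m k t ht =>
    ((hsol.isModeSolution k).comp ((Commute.refl _).pow_left m)).norm_le hε hb le_rfl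
      (hT₀.trans ht)
  have hsum : ∀ (s : ℕ) (f g : L2), sobolevNorm s f + sobolevNorm s g ≤ K → ∀ S : Finset ℤ,
      ∑ k ∈ S, (1 + (k : ℝ) ^ 2) ^ s * (‖coeffL k f‖ ^ 2 + ‖coeffL k g‖ ^ 2) ≤ 2 * (K : ℝ) ^ 2 := by
    intro s f g h S
    have h1 : ∀ f : L2, sobolevNorm s f ≤ K →
        ∑ k ∈ S, (1 + (k : ℝ) ^ 2) ^ s * ‖coeffL k f‖ ^ 2 ≤ (K : ℝ) ^ 2 := by
      intro f hf
      have h2 : sobolevNorm s f ^ 2 ≤ ((K ^ 2 : ℝ≥0) : ℝ≥0∞) := by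
        push_cast
        gcongr
      exact_mod_cast sum_le_of_sobolevNorm_sq_le h2 S
    simp_rw [mul_add, Finset.sum_add_distrib]
    linarith [h1 f (le_self_add.trans h), h1 g (le_add_self.trans h)]
  set X : ℤ → ℝ := fun k => ‖(modeOp b ε k ^ (q + 1)) (modeCurve u w k 0)‖ with hX
  set Z : ℤ → ℝ := fun k => |(k : ℝ)| * ‖(modeOp b ε k ^ q) (modeCurve u w k 0)‖ with hZ
  have hX0 : ∀ k, 0 ≤ X k := fun k => norm_nonneg _
  have hZ0 : ∀ k, 0 ≤ Z k := fun k => by positivity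
  -- One bound for both quantities: `X` and `Z` are their values at time `0`, and `κ` is the energy
  -- growth constant.
  refine ⟨fun k => κ * (X k + Z k), fun k => mul_nonneg hκ0 (add_nonneg (hX0 k) (hZ0 k)),
    fun k t ht => (hgrow (q + 1) k t ht).trans ?_, fun k t ht => ?_, fun S => ?_⟩
  · exact mul_le_mul_of_nonneg_left (le_add_of_nonneg_right (hZ0 k)) hκ0
  · calc |(k : ℝ)| * ‖(modeOp b ε k ^ q) (modeCurve u w k t)‖
        ≤ |(k : ℝ)| * (κ * ‖(modeOp b ε k ^ q) (modeCurve u w k 0)‖) := by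
          gcongr
          exact hgrow q k t ht
      _ = κ * Z k := by rw [hZ]; ring
      _ ≤ κ * (X k + Z k) := by
          gcongr
          exact le_add_of_nonneg_left (hX0 k)
  · have h1 := hsum 1 _ _ hdata.bound_one S
    have h2 := hsum 2 _ _ hdata.bound_two S
    have hle : ∀ k ∈ S, (κ * (X k + Z k)) ^ 2 ≤ 2 * κ ^ 2 *
        ((1 + (k : ℝ) ^ 2) ^ 1 * (‖coeffL k (timeDerivZero (q + 1) u)‖ ^ 2
            + ‖coeffL k (timeDerivZero (q + 1) w)‖ ^ 2)
          + (1 + (k : ℝ) ^ 2) ^ 2 * (‖coeffL k (timeDerivZero q u)‖ ^ 2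
            + ‖coeffL k (timeDerivZero q w)‖ ^ 2)) := by
      intro k _
      have h3 : X k ^ 2 ≤ ‖coeffL k (timeDerivZero (q + 1) u)‖ ^ 2
          + ‖coeffL k (timeDerivZero (q + 1) w)‖ ^ 2 := by
        simp only [hX]
        rw [hpow (q + 1) le_rfl]
        exact norm_prod_sq_le _
      have h4 : Z k ^ 2 ≤ (k : ℝ) ^ 2 * (‖coeffL k (timeDerivZero q u)‖ ^ 2
          + ‖coeffL k (timeDerivZero q w)‖ ^ 2) := by
        simp only [hZ]
        rw [hpow q (by omega), mul_pow, sq_abs]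
        gcongr
        exact norm_prod_sq_le _
      have h5 : X k ^ 2 ≤ (1 + (k : ℝ) ^ 2) ^ 1 * (‖coeffL k (timeDerivZero (q + 1) u)‖ ^ 2
          + ‖coeffL k (timeDerivZero (q + 1) w)‖ ^ 2) := by
        refine h3.trans (le_mul_of_one_le_left (by positivity) ?_)
        nlinarith [sq_nonneg (k : ℝ)]
      have h6 : Z k ^ 2 ≤ (1 + (k : ℝ) ^ 2) ^ 2 * (‖coeffL k (timeDerivZero q u)‖ ^ 2
          + ‖coeffL k (timeDerivZero q w)‖ ^ 2) := by
        refine h4.trans (mul_le_mul_of_nonneg_right ?_ (by positivity))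
        nlinarith [sq_nonneg (k : ℝ)]
      have h7 : (X k + Z k) ^ 2 ≤ 2 * (X k ^ 2 + Z k ^ 2) := add_sq_le
      calc (κ * (X k + Z k)) ^ 2 = κ ^ 2 * (X k + Z k) ^ 2 := by ring
        _ ≤ κ ^ 2 * (2 * (X k ^ 2 + Z k ^ 2)) := by gcongr
        _ = 2 * κ ^ 2 * (X k ^ 2 + Z k ^ 2) := by ring
        _ ≤ _ := by gcongr
    refine (Finset.sum_le_sum hle).trans ?_
    rw [← Finset.mul_sum, Finset.sum_add_distrib]
    calc _ ≤ 2 * κ ^ 2 * (2 * (K : ℝ) ^ 2 + 2 * (K : ℝ) ^ 2) := by gcongr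
      _ = _ := by ring

theorem exists_modeBound_of_layer (q : ℕ) (hq4 : q ≤ 4) (b : ℝ) (hb : |b| < 1) (K : ℝ≥0) :
    ∃ R : ℝ, 0 ≤ R ∧ ∀ (ε T₀ : ℝ) (u w : ℝ → L2), 0 < ε → 0 ≤ T₀ → IsSolution b ε u w →
      sobolevNorm (q + 2) (u 0) ^ 2 + sobolevNorm (q + 2) (w 0) ^ 2 ≤ K →
      ((q : ℝ) + 2) * ε * Real.log (1 / ε) ≤ T₀ → ∃ B, IsModeBound q b ε T₀ R u w B := by
  obtain ⟨C, hC, hlayer⟩ := exists_layer_constant q hq4 b hb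
  refine ⟨C ^ 2 * 2 ^ (q + 1) * (2 * K), by positivity, ?_⟩
  intro ε T₀ u w hε hT₀ hsol hdata hlog
  have hm := fun k => hlayer ε T₀ k (modeCurve u w k) hε hT₀ (hsol.isModeSolution k) hlog
  refine ⟨fun k => C * (1 + |(k : ℝ)|) ^ (q + 1) * ‖modeCurve u w k 0‖, fun k => by positivity,
    fun k => hm k (q + 1) le_rfl, fun k t ht => ?_, fun S => ?_⟩
  · calc |(k : ℝ)| * ‖(modeOp b ε k ^ q) (modeCurve u w k t)‖
        ≤ (1 + |(k : ℝ)|) * (C * (1 + |(k : ℝ)|) ^ q * ‖modeCurve u w k 0‖) := by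
          gcongr
          · linarith
          · exact hm k q (by omega) t ht
      _ = _ := by ring
  · have hu := sum_le_of_sobolevNorm_sq_le (le_self_add.trans hdata) S
    have hw := sum_le_of_sobolevNorm_sq_le (le_add_self.trans hdata) S
    have hle : ∀ k ∈ S, (C * (1 + |(k : ℝ)|) ^ (q + 1) * ‖modeCurve u w k 0‖) ^ 2
        ≤ C ^ 2 * 2 ^ (q + 1) * ((1 + (k : ℝ) ^ 2) ^ (q + 2) * ‖coeffL k (u 0)‖ ^ 2
          + (1 + (k : ℝ) ^ 2) ^ (q + 2) * ‖coeffL k (w 0)‖ ^ 2) := by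
      intro k _
      have h1 : (1 + |(k : ℝ)|) ^ 2 ≤ 2 * (1 + (k : ℝ) ^ 2) := by
        rw [← sq_abs (k : ℝ)]
        nlinarith [sq_nonneg (1 - |(k : ℝ)|)]
      have h2 : ‖modeCurve u w k 0‖ ^ 2 ≤ ‖coeffL k (u 0)‖ ^ 2 + ‖coeffL k (w 0)‖ ^ 2 :=
        norm_prod_sq_le _
      have h3 : (1 + (k : ℝ) ^ 2) ^ (q + 1) ≤ (1 + (k : ℝ) ^ 2) ^ (q + 2) :=
        pow_le_pow_right₀ (by nlinarith [sq_nonneg (k : ℝ)]) (by omega)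
      calc (C * (1 + |(k : ℝ)|) ^ (q + 1) * ‖modeCurve u w k 0‖) ^ 2
          = C ^ 2 * ((1 + |(k : ℝ)|) ^ 2) ^ (q + 1) * ‖modeCurve u w k 0‖ ^ 2 := by
            rw [mul_pow, mul_pow, ← pow_mul, ← pow_mul, mul_comm 2]
        _ ≤ C ^ 2 * (2 * (1 + (k : ℝ) ^ 2)) ^ (q + 1)
              * (‖coeffL k (u 0)‖ ^ 2 + ‖coeffL k (w 0)‖ ^ 2) := by gcongr
        _ = C ^ 2 * 2 ^ (q + 1) * ((1 + (k : ℝ) ^ 2) ^ (q + 1)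
              * (‖coeffL k (u 0)‖ ^ 2 + ‖coeffL k (w 0)‖ ^ 2)) := by rw [mul_pow]; ring
        _ ≤ C ^ 2 * 2 ^ (q + 1) * ((1 + (k : ℝ) ^ 2) ^ (q + 2)
              * (‖coeffL k (u 0)‖ ^ 2 + ‖coeffL k (w 0)‖ ^ 2)) := by gcongr
        _ = _ := by ring
    refine (Finset.sum_le_sum hle).trans ?_
    rw [← Finset.mul_sum, Finset.sum_add_distrib]
    gcongr
    linarith

/-! ### The error estimate -/

/-- The coefficients are constant in `x`, so taking a Fourier coefficient turns `trigDeriv` into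
multiplication by `ik`. -/
theorem IsScheme.mode_step {q : ℕ} {b ε Δt T₀ : ℝ} {N : ℕ} {u w : ℝ → L2} {U W : ℕ → L2}
    (h : IsScheme q b ε Δt T₀ N u w U W) {k : ℤ} (hk : k ∈ Finset.Icc (-(N : ℤ)) N) (n : ℕ) :
    ∑ i ∈ Finset.range (q + 1), bdfAlpha q i • (coeffL k (U (n + i)), coeffL k (W (n + i)))
      + (Δt * k) • ∑ i ∈ Finset.range q, bdfGamma q i • Complex.I •
          fluxOp b (coeffL k (U (n + i)), coeffL k (W (n + i)))
      + (bdfBeta q * Δt / ε) • relaxOp (coeffL k (U (n + q)), coeffL k (W (n + q))) = 0 := by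
  have h1 := congrArg (coeffL k) (h.step_U n)
  have h2 := congrArg (coeffL k) (h.step_W n)
  simp only [map_add, map_sub, map_neg, map_sum, map_zero, ContinuousLinearMap.map_smul_of_tower,
    coeffL_trigDeriv hk] at h1 h2
  simp only [fluxOp_apply, relaxOp_apply]
  ext
  · simp only [Prod.fst_add, Prod.fst_sum, Prod.smul_fst, Prod.fst_zero, smul_zero, add_zero]
    rw [← h1]
    congr 1
    rw [mul_smul]
    congr 1
    rw [Finset.smul_sum]
    refine Finset.sum_congr rfl fun i _ => ?_
    simp
    ring
  · simp only [Prod.snd_add, Prod.snd_sum, Prod.smul_snd, Prod.snd_zero]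
    rw [← eq_neg_iff_add_eq_zero, ← h2]
    congr 1
    rw [mul_smul]
    congr 1
    rw [Finset.smul_sum]
    refine Finset.sum_congr rfl fun i _ => ?_
    simp
    ring

/-- The error of the scheme for a solution with bounded time derivatives. -/
theorem exists_error_constant (q : ℕ) (hq1 : 1 ≤ q) (hq4 : q ≤ 4) (b : ℝ) (hb : |b| < 1)
    (c : ℝ) (hc : 0 ≤ c) (T R : ℝ) (hR : 0 ≤ R) :
    ∃ C : ℝ, 0 < C ∧ ∀ (ε : ℝ) (N : ℕ) (Δt T₀ : ℝ) (u w : ℝ → L2) (B : ℤ → ℝ) (U W : ℕ → L2),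
      0 < ε → 0 < Δt → Δt * (N : ℝ) ^ 2 ≤ c → Δt ≤ 1 → 0 ≤ T₀ → IsSolution b ε u w →
      IsModeBound q b ε T₀ R u w B → IsScheme q b ε Δt T₀ N u w U W →
      ∀ n : ℕ, T₀ + n * Δt ≤ T →
        ‖u (T₀ + n * Δt) - U n‖ ^ 2 + ‖w (T₀ + n * Δt) - W n‖ ^ 2
          ≤ C * (Δt ^ (2 * q) + projError q ε Δt T₀ N u w) := by
  have hb1 : b ^ 2 < 1 := by rwa [sq_lt_one_iff_abs_lt_one]
  have hb2 : 0 < 1 - b ^ 2 := by linarith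
  obtain ⟨C, hC, hmode⟩ := exists_mode_error_constant q hq1 hq4 b hb c hc T
  set κ := 2 / (1 - b ^ 2) with hκ
  have hκ0 : 0 < κ := by positivity
  refine ⟨2 * C * R + 2 * κ, by positivity, ?_⟩
  intro ε N Δt T₀ u w B U W hε hΔ hN hΔ1 hT₀ hsol ⟨hB0, hB1, hB2, hBR⟩ hsch n hn
  set t := T₀ + n * Δt with ht
  have hT₀t : T₀ ≤ t := by
    have : 0 ≤ n * Δt := by positivity
    linarith
  set S := Finset.Icc (-(N : ℤ)) N with hS
  have hpair : ∀ x : ℂ × ℂ, ‖x.1‖ ^ 2 + ‖x.2‖ ^ 2 ≤ 2 * ‖x‖ ^ 2 := fun x => by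
    have h1 : ‖x.1‖ ^ 2 ≤ ‖x‖ ^ 2 := by gcongr; exact norm_fst_le x
    have h2 : ‖x.2‖ ^ 2 ≤ ‖x‖ ^ 2 := by gcongr; exact norm_snd_le x
    linarith
  have hinside : ∀ k ∈ S, ‖coeffL k (u t - U n)‖ ^ 2 + ‖coeffL k (w t - W n)‖ ^ 2
      ≤ 2 * C * Δt ^ (2 * q) * B k ^ 2 := by
    intro k hk
    have hkN : (k : ℝ) ^ 2 ≤ (N : ℝ) ^ 2 := by
      rw [sq_le_sq, Nat.abs_cast, abs_le]
      have := Finset.mem_Icc.1 hk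
      exact ⟨by exact_mod_cast this.1, by exact_mod_cast this.2⟩
    have h1 := hmode ε Δt T₀ (B k) k (modeCurve u w k) (fun n => (coeffL k (U n), coeffL k (W n)))
      hε hΔ hΔ1 (le_trans (by gcongr) hN) hT₀ (hB0 k) (hsol.isModeSolution k) (hB1 k) (hB2 k)
      (fun i hi => by
        simp only [modeCurve]
        rw [hsch.start_U i hi, hsch.start_W i hi, coeffL_proj, coeffL_proj, if_pos hk, if_pos hk])
      (hsch.mode_step hk) n (by linarith)
    have h2 := hpair (modeCurve u w k t - (coeffL k (U n), coeffL k (W n)))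
    simp only [modeCurve, Prod.fst_sub, Prod.snd_sub, ← map_sub] at h1 h2
    linarith
  -- Here the numerical solution vanishes, and the energy estimate bounds the exact mode by its
  -- value at `T₀`; only the `i = 0` term of `projError` is needed.
  have houtside : ∀ k ∉ S, ‖coeffL k (u t - U n)‖ ^ 2 + ‖coeffL k (w t - W n)‖ ^ 2
      ≤ 2 * κ * (‖coeffL k (u T₀ - proj N (u T₀))‖ ^ 2
        + ‖coeffL k (w T₀ - proj N (w T₀))‖ ^ 2) := by
    intro k hk
    rw [map_sub, map_sub, map_sub, map_sub, coeffL_of_mem_trigPoly hk (hsch.mem_U n),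
      coeffL_of_mem_trigPoly hk (hsch.mem_W n), coeffL_proj, coeffL_proj, if_neg hk, if_neg hk]
    simp only [sub_zero]
    have h1 := (hsol.isModeSolution k).norm_sq_le hε hb hT₀ hT₀t
    have h2 := hpair (modeCurve u w k t)
    have h3 := norm_prod_sq_le (modeCurve u w k T₀)
    calc _ ≤ 2 * ‖modeCurve u w k t‖ ^ 2 := h2
      _ ≤ 2 * (κ * ‖modeCurve u w k T₀‖ ^ 2) := by gcongr
      _ ≤ 2 * (κ * (‖coeffL k (u T₀)‖ ^ 2 + ‖coeffL k (w T₀)‖ ^ 2)) := by gcongr; exact h3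
      _ = _ := by ring
  have hsumB : HasSum (fun k => if k ∈ S then 2 * C * Δt ^ (2 * q) * B k ^ 2 else 0)
      (∑ k ∈ S, 2 * C * Δt ^ (2 * q) * B k ^ 2) := by
    rw [← Finset.sum_congr rfl fun k hk => if_pos hk]
    exact hasSum_sum_of_ne_finset_zero fun k hk => if_neg hk
  -- Parseval on both sides; the two kinds of modes are compared termwise afterwards.
  have hle := hasSum_le (fun k => ?_)
    ((hasSum_sq_coeffL (u t - U n)).add (hasSum_sq_coeffL (w t - W n)))
    (hsumB.add (((hasSum_sq_coeffL (u T₀ - proj N (u T₀))).add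
      (hasSum_sq_coeffL (w T₀ - proj N (w T₀)))).mul_left (2 * κ)))
  · have hproj : ‖u T₀ - proj N (u T₀)‖ ^ 2 + ‖w T₀ - proj N (w T₀)‖ ^ 2
        ≤ projError q ε Δt T₀ N u w := by
      have h1 : 0 ≤ Δt / ε := by positivity
      refine le_trans ?_ (Finset.single_le_sum (f := fun i : ℕ =>
        ‖u (T₀ + i * Δt) - proj N (u (T₀ + i * Δt))‖ ^ 2
          + (1 + Δt / ε) * ‖w (T₀ + i * Δt) - proj N (w (T₀ + i * Δt))‖ ^ 2)
        (fun _ _ => by positivity) (Finset.mem_range.2 hq1))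
      simp only [Nat.cast_zero, zero_mul, add_zero]
      gcongr
      exact le_mul_of_one_le_left (by positivity) (by linarith)
    have hproj0 : 0 ≤ projError q ε Δt T₀ N u w := le_trans (by positivity) hproj
    rw [← Finset.mul_sum] at hle
    refine hle.trans ?_
    have h1 : 0 ≤ 2 * κ * Δt ^ (2 * q) := by positivity
    have h2 : 0 ≤ 2 * C * R * projError q ε Δt T₀ N u w := by positivity
    calc _ ≤ 2 * C * Δt ^ (2 * q) * R + 2 * κ * projError q ε Δt T₀ N u w := by
          gcongr
          exact hBR S
      _ ≤ _ := by linarith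
  · by_cases hk : k ∈ S
    · rw [if_pos hk]
      exact (hinside k hk).trans (le_add_of_nonneg_right (by positivity))
    · rw [if_neg hk, zero_add]
      exact houtside k hk

end IMEXBDF

/-! ### The two kinds of well-prepared data combined -/

theorem mainTheorem1 (q : ℕ) (hq1 : 1 ≤ q) (hq4 : q ≤ 4) (b : ℝ) (hb : |b| < 1)
    (cCFL : ℝ) (hcCFL : 0 < cCFL) (T : ℝ) (K : ℝ≥0) :
    ∃ C : ℝ, 0 < C ∧
      ∀ (ε : ℝ), 0 < ε →
      ∀ (N : ℕ) (Δt : ℝ), 0 < Δt → Δt * (N : ℝ) ^ 2 ≤ cCFL → Δt ≤ 1 →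
      ∀ (T₀ : ℝ), 0 ≤ T₀ →
      ∀ (u w : ℝ → IMEXBDF.L2), IMEXBDF.IsSolution b ε u w →
        (IMEXBDF.ConsistentData q K u w ∨
          (IMEXBDF.sobolevNorm (q + 2) (u 0) ^ 2 + IMEXBDF.sobolevNorm (q + 2) (w 0) ^ 2 ≤ K ∧
            ((q : ℝ) + 2) * ε * Real.log (1 / ε) ≤ T₀)) →
      ∀ (U W : ℕ → IMEXBDF.L2), IMEXBDF.IsScheme q b ε Δt T₀ N u w U W →
      ∀ (n : ℕ), T₀ + n * Δt ≤ T →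
        ‖u (T₀ + n * Δt) - U n‖ ^ 2 + ‖w (T₀ + n * Δt) - W n‖ ^ 2
          ≤ C * (Δt ^ (2 * q) + IMEXBDF.projError q ε Δt T₀ N u w) := by
  obtain ⟨R₁, hR₁, h₁⟩ := IMEXBDF.exists_modeBound_of_consistent q b hb K
  obtain ⟨R₂, hR₂, h₂⟩ := IMEXBDF.exists_modeBound_of_layer q hq4 b hb K
  -- The sum `R₁ + R₂` dominates the bound of either case, so one constant serves both.
  obtain ⟨C, hC, h⟩ := IMEXBDF.exists_error_constant q hq1 hq4 b hb cCFL hcCFL.le T (R₁ + R₂)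
    (add_nonneg hR₁ hR₂)
  refine ⟨C, hC, ?_⟩
  intro ε hε N Δt hΔ hN hΔ1 T₀ hT₀ u w hsol hdata U W hsch
  obtain ⟨B, hB⟩ : ∃ B, IMEXBDF.IsModeBound q b ε T₀ (R₁ + R₂) u w B := by
    rcases hdata with hdata | ⟨hdata, hlog⟩
    · obtain ⟨B, h0, h1, h2, h3⟩ := h₁ ε T₀ u w hε hT₀ hsol hdata
      exact ⟨B, h0, h1, h2, fun S => (h3 S).trans (le_add_of_nonneg_right hR₂)⟩
    · obtain ⟨B, h0, h1, h2, h3⟩ := h₂ ε T₀ u w hε hT₀ hsol hdata hlog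
      exact ⟨B, h0, h1, h2, fun S => (h3 S).trans (le_add_of_nonneg_left hR₁)⟩
  exact h ε N Δt T₀ u w B U W hε hΔ hN hΔ1 hT₀ hsol hB hsch
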